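/- Let $\alpha_1,\alpha_2,\beta_1,\beta_2>0$ and let $\{X(t):t\ge 0\}$ be a time-homogeneous continuous-time Markov chain on $\mathbb{Z}$ whose state probabilities $p_{k,n}(t)=P(X(t)=n\mid X(0)=k)$ have generator $g_{k,n}=\lim_{t\downarrow 0}\frac{p_{k,n}(t)-p_{k,n}(0)}{t}$ given by $$g_{k,k+1}=\alpha_1,\quad g_{k,k-1}=\alpha_2,\quad g_{k,k}=-(\alpha_1+\alpha_2)\quad (k\text{ even}),$$ $$g_{k,k+1}=\beta_1,\quad g_{k,k-1}=\beta_2,\quad g_{k,k}=-(\beta_1+\beta_2)\quad (k\text{ odd}),$$ and $g_{k,n}=0$ if $|k-n|\ge 2$. For $\gamma\in\mathbb{R}$ let $$\Lambda(\gamma)=\frac{h(e^\gamma)}{e^\gamma}-\frac{\alpha_1+\alpha_2+\beta_1+\beta_2}{2},\qquad h(z)=\tfrac12\sqrt{(\alpha_1+\alpha_2-(\beta_1+\beta_2))^2z^2+4(\beta_1z^2+\beta_2)(\alpha_1z^2+\alpha_2)}.$$ Let $\{a_t:t>0\}$ be positive numbers such that $a_t\to 0$ and $ta_t\to+\infty$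 as $t\to+\infty$. Then $\Lambda''(0)>0$, and for every $k\in\mathbb{Z}$ the expectations $\mathbb{E}[X(t)\mid X(0)=k]$, $t\ge 0$, are finite and the family of laws $$\pi_t=P\left(\sqrt{ta_t}\,\frac{X(t)-\mathbb{E}[X(t)\mid X(0)=k]}{t}\in\cdot\;\Big|\;X(0)=k\right),\quad t>0,$$ satisfies the large deviation principle on $\mathbb{R}$ with speed function $v_t=1/a_t$ and good rate function $J(y)=\frac{y^2}{2\Lambda''(0)}$. That is, $v_t\to+\infty$, $J$ is lower semicontinuous with compact level sets $\{y:J(y)\le\eta\}$ for all $\eta\ge 0$, $$\liminf_{t\to+\infty}\frac1{v_t}\log\pi_t(O)\ge-\inf_{y\in O}J(y)\ \text{ for all open } O\subseteq\mathbb{R},\qquad \limsup_{t\to+\infty}\frac1{v_t}\log\pi_t(C)\le-\inf_{y\in C}J(y)\ \text{ for all closed } C\subseteq\mathbb{R}.$$ -/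

import Mathlib

open Filter Topology MeasureTheory
open scoped NNReal ENNReal

/-- The generator of the chain on `ℤ` with alternating rates: from an even state, rate `α₁` to the
right and `α₂` to the left; from an odd state, rate `β₁` to the right and `β₂` to the left. -/
noncomputable def alternatingGenerator (α₁ α₂ β₁ β₂ : ℝ) (k n : ℤ) : ℝ :=
  if n = k + 1 then (if Even k then α₁ else β₁)
  else if n = k - 1 then (if Even k then α₂ else β₂)
  else if n = k then (if Even k then -(α₁ + α₂) else -(β₁ + β₂))
  else 0

/-- State probabilities `p_{k,n}(t) = P(X(t) = n | X(0) = k)`, where `P k` is the law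
`P(· | X(0) = k)` of the chain started at `k`. -/
noncomputable def stateProb {Ω : Type*} [MeasurableSpace Ω] (P : ℤ → Measure Ω)
    (X : ℝ≥0 → Ω → ℤ) (k n : ℤ) (t : ℝ≥0) : ℝ :=
  (P k).real {ω | X t ω = n}

/-- `(X, (P k)_{k ∈ ℤ})` is a (time-homogeneous) continuous-time Markov chain on `ℤ`, `P k` being
the probability given `X(0) = k`. In the Markov property, `A` ranges over the events determined by
the path up to time `s`. -/
structure IsMarkovChain {Ω : Type*} [MeasurableSpace Ω] (P : ℤ → Measure Ω)
    (X : ℝ≥0 → Ω → ℤ) : Prop where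
  measurable : ∀ t, Measurable (X t)
  isProbabilityMeasure : ∀ k, IsProbabilityMeasure (P k)
  start : ∀ k, ∀ᵐ ω ∂(P k), X 0 ω = k
  markov : ∀ (k : ℤ) (s t : ℝ≥0) (A : Set Ω) (j n : ℤ),
    MeasurableSet[⨆ u : Set.Iic s, MeasurableSpace.comap (X u) ⊤] A →
    (P k).real (A ∩ {ω | X s ω = j} ∩ {ω | X (s + t) ω = n})
      = (P k).real (A ∩ {ω | X s ω = j}) * stateProb P X j n t

/-- The chain has generator `g`: `g k n` is the derivative of `p_{k,n}` at time `0`. -/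
def HasGenerator {Ω : Type*} [MeasurableSpace Ω] (P : ℤ → Measure Ω)
    (X : ℝ≥0 → Ω → ℤ) (g : ℤ → ℤ → ℝ) : Prop :=
  ∀ k n : ℤ, Tendsto (fun t : ℝ≥0 => (stateProb P X k n t - stateProb P X k n 0) / (t : ℝ))
    (𝓝[>] 0) (𝓝 (g k n))

/-- The function `h̃(z; α₁, α₂, β₁, β₂)`. -/
noncomputable def hTilde (α₁ α₂ β₁ β₂ z : ℝ) : ℝ :=
  (α₁ + α₂ - (β₁ + β₂)) ^ 2 * z ^ 2 + 4 * (β₁ * z ^ 2 + β₂) * (α₁ * z ^ 2 + α₂)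

/-- The function `h(z)`. -/
noncomputable def hFun (α₁ α₂ β₁ β₂ z : ℝ) : ℝ :=
  1 / 2 * Real.sqrt (hTilde α₁ α₂ β₁ β₂ z)

/-- The function `Λ(γ) = h(e^γ) / e^γ - (α₁ + α₂ + β₁ + β₂) / 2`. -/
noncomputable def LambdaFun (α₁ α₂ β₁ β₂ γ : ℝ) : ℝ :=
  hFun α₁ α₂ β₁ β₂ (Real.exp γ) / Real.exp γ - (α₁ + α₂ + β₁ + β₂) / 2

/-- `Λ''(0)`. -/
noncomputable def LambdaSecond (α₁ α₂ β₁ β₂ : ℝ) : ℝ :=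
  deriv (deriv (LambdaFun α₁ α₂ β₁ β₂)) 0

/-- The large deviation principle, as `t → ∞`, for a family of probability measures `π t`, `t > 0`,
with speed function `v` and rate function `I`. Logarithms and inequalities are taken in the
extended reals (`ENNReal.log 0 = ⊥`). -/
structure SatisfiesLDP {Y : Type*} [TopologicalSpace Y] [MeasurableSpace Y]
    (π : ℝ≥0 → Measure Y) (v : ℝ≥0 → ℝ) (I : Y → ℝ≥0∞) : Prop where
  isProbabilityMeasure : ∀ t, 0 < t → IsProbabilityMeasure (π t)
  speed : Tendsto v atTop atTop
  lsc : LowerSemicontinuous I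
  lower : ∀ O : Set Y, IsOpen O →
    -((⨅ y ∈ O, I y : ℝ≥0∞) : EReal)
      ≤ liminf (fun t => ((1 / v t : ℝ) : EReal) * ENNReal.log (π t O)) atTop
  upper : ∀ C : Set Y, IsClosed C →
    limsup (fun t => ((1 / v t : ℝ) : EReal) * ENNReal.log (π t C)) atTop
      ≤ -((⨅ y ∈ C, I y : ℝ≥0∞) : EReal)

/-- A rate function is good if its level sets are compact. -/
def IsGoodRate {Y : Type*} [TopologicalSpace Y] (I : Y → ℝ≥0∞) : Prop :=
  ∀ η : ℝ≥0, IsCompact {y | I y ≤ (η : ℝ≥0∞)}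

/-!
The parity of the chain has only two states, so for each `γ` the generator has an eigenfunction
`n ↦ e^{γ n} v(n)` with eigenvalue `Λ(γ)`, where `v` is positive and depends only on the parity
of `n`. Hence `E_k[e^{γ X(t)} v(X(t))] = e^{γ k + t Λ(γ)} v(k)`, and `log E_k[e^{γ X(t)}]` differs
from `t Λ(γ)` by a constant which is uniform in `t ≥ 0` and in `γ` near `0`. Taking
`γ = θ / √(t a_t)`, the second order expansion of `Λ` at `0` shows that the scaled cumulant
generating functions converge to `Λ''(0) θ² / 2`; centering at the mean instead of at `t Λ'(0)` is
harmless by Jensen's inequality. A quadratic limit gives the large deviation principle by the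
Gärtner–Ellis argument, Chernoff's inequality for closed sets and tilting for open sets.
-/

/-! ### Markov chains with a generator -/

section Chain

variable {Ω : Type*} [MeasurableSpace Ω] {P : ℤ → Measure Ω} {X : ℝ≥0 → Ω → ℤ}

theorem stateProb_nonneg (k n : ℤ) (t : ℝ≥0) : 0 ≤ stateProb P X k n t :=
  measureReal_nonneg

theorem HasGenerator.hasDerivWithinAt_zero {g : ℤ → ℤ → ℝ} (hG : HasGenerator P X g) (k n : ℤ) :
    HasDerivWithinAt (fun y : ℝ => stateProb P X k n y.toNNReal) (g k n) (Set.Ici 0) 0 := by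
  have htoNNReal : Tendsto Real.toNNReal (𝓝[>] 0) (𝓝[>] 0) := by
    refine tendsto_nhdsWithin_iff.2 ⟨?_, ?_⟩
    · exact (continuous_real_toNNReal.tendsto' 0 0 Real.toNNReal_zero).mono_left nhdsWithin_le_nhds
    · filter_upwards [self_mem_nhdsWithin] with y hy using Real.toNNReal_pos.2 hy
  rw [← hasDerivWithinAt_Ioi_iff_Ici, hasDerivWithinAt_iff_tendsto_slope' (by simp)]
  refine ((hG k n).comp htoNNReal).congr' ?_
  filter_upwards [self_mem_nhdsWithin] with y hy
  simp [slope_def_field, Real.coe_toNNReal y (le_of_lt hy)]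

namespace IsMarkovChain

theorem measurableSet_eq (hX : IsMarkovChain P X) (t : ℝ≥0) (n : ℤ) :
    MeasurableSet {ω | X t ω = n} :=
  hX.measurable t (measurableSet_singleton n)

theorem stateProb_le_one (hX : IsMarkovChain P X) (k n : ℤ) (t : ℝ≥0) :
    stateProb P X k n t ≤ 1 :=
  have := hX.isProbabilityMeasure k
  measureReal_le_one

theorem stateProb_zero (hX : IsMarkovChain P X) (k n : ℤ) :
    stateProb P X k n 0 = if n = k then 1 else 0 := by
  have := hX.isProbabilityMeasure k
  unfold stateProb
  split_ifs with h
  · rw [measureReal_congr (t := Set.univ), probReal_univ]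
    filter_upwards [hX.start k] with ω hω
    exact eq_true (hω.trans h.symm)
  · rw [measureReal_congr (t := ∅), measureReal_empty]
    filter_upwards [hX.start k] with ω hω
    exact eq_false fun h' : X 0 ω = n => h (h'.symm.trans hω)

theorem measureReal_inter (hX : IsMarkovChain P X) (k j n : ℤ) (s t : ℝ≥0) :
    (P k).real ({ω | X s ω = j} ∩ {ω | X (s + t) ω = n})
      = stateProb P X k j s * stateProb P X j n t := by
  simpa [stateProb] using hX.markov k s t Set.univ j n MeasurableSet.univ

theorem stateProb_add_sub_sum_mem_Icc (hX : IsMarkovChain P X) (S : Finset ℤ) (k n : ℤ)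
    (s t : ℝ≥0) :
    stateProb P X k n (s + t) - ∑ j ∈ S, stateProb P X k j s * stateProb P X j n t
      ∈ Set.Icc 0 (1 - ∑ j ∈ S, stateProb P X k j s) := by
  have := hX.isProbabilityMeasure k
  set E := {ω | X (s + t) ω = n}
  set F := ⋃ j ∈ S, {ω | X s ω = j}
  have hF : MeasurableSet F := S.measurableSet_biUnion fun j _ => hX.measurableSet_eq s j
  have hdisj : Set.PairwiseDisjoint (S : Set ℤ) fun j => {ω | X s ω = j} :=
    fun i _ j _ hij => Set.disjoint_left.2 fun _ hi hj => hij (hi.symm.trans hj)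
  have hPF : ∑ j ∈ S, stateProb P X k j s = (P k).real F :=
    (measureReal_biUnion_finset hdisj fun j _ => hX.measurableSet_eq s j).symm
  have hPEF : ∑ j ∈ S, stateProb P X k j s * stateProb P X j n t = (P k).real (E ∩ F) := by
    rw [Set.inter_comm, Set.iUnion₂_inter, measureReal_biUnion_finset
      (hdisj.mono fun j => Set.inter_subset_left)
      fun j _ => (hX.measurableSet_eq s j).inter (hX.measurableSet_eq _ n)]
    exact Finset.sum_congr rfl fun j _ => (hX.measureReal_inter k j n s t).symm
  have hsub : stateProb P X k n (s + t) - (P k).real (E ∩ F) = (P k).real (E \ F) :=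
    sub_eq_of_eq_add' (measureReal_inter_add_sdiff hF).symm
  rw [hPF, hPEF, hsub, ← probReal_compl_eq_one_sub hF]
  exact ⟨measureReal_nonneg, measureReal_mono fun ω hω => hω.2⟩

theorem abs_stateProb_add_sub_le (hX : IsMarkovChain P X) (k n : ℤ) (s t : ℝ≥0) :
    |stateProb P X k n (s + t) - stateProb P X k n t| ≤ 1 - stateProb P X k k s := by
  obtain ⟨hl, hu⟩ := hX.stateProb_add_sub_sum_mem_Icc {k} k n s t
  simp only [Finset.sum_singleton] at hl hu
  have h0 := stateProb_nonneg (P := P) (X := X) k n t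
  have h1 := hX.stateProb_le_one k n t
  rw [abs_le]
  constructor <;> nlinarith

variable {g : ℤ → ℤ → ℝ}

theorem generator_nonneg (hX : IsMarkovChain P X) (hG : HasGenerator P X g) {k n : ℤ}
    (hkn : n ≠ k) : 0 ≤ g k n :=
  ge_of_tendsto' (hG k n) fun t => by
    rw [hX.stateProb_zero, if_neg hkn, sub_zero]
    exact div_nonneg (stateProb_nonneg k n t) t.2

theorem continuous_stateProb (hX : IsMarkovChain P X) (hG : HasGenerator P X g) (k n : ℤ) :
    Continuous (stateProb P X k n) := by
  have hkk : Tendsto (fun s => 1 - stateProb P X k k s) (𝓝 0) (𝓝 0) := by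
    have hcoe : Tendsto ((↑) : ℝ≥0 → ℝ) (𝓝 0) (𝓝[≥] 0) :=
      tendsto_nhdsWithin_iff.2
        ⟨NNReal.continuous_coe.tendsto' 0 0 rfl, Eventually.of_forall fun s => s.2⟩
    have h := ((hG.hasDerivWithinAt_zero k k).continuousWithinAt.tendsto.comp hcoe).const_sub 1
    simpa [Function.comp_def, hX.stateProb_zero] using h
  have hdist_of_le {u v : ℝ≥0} (huv : u ≤ v) :
      dist (stateProb P X k n u) (stateProb P X k n v) ≤ 1 - stateProb P X k k (nndist u v) := by
    obtain ⟨s, rfl⟩ := exists_add_of_le huv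
    have hs : nndist u (u + s) = s := by
      simp [nndist_comm u, ← NNReal.coe_inj, NNReal.dist_eq]
    rw [dist_comm, Real.dist_eq, hs, add_comm]
    exact hX.abs_stateProb_add_sub_le k n s u
  refine continuous_iff_continuousAt.2 fun t => tendsto_iff_dist_tendsto_zero.2 ?_
  have hnn : Tendsto (fun s : ℝ≥0 => nndist s t) (𝓝 t) (𝓝 0) :=
    (continuous_id.nndist continuous_const).tendsto' t 0 (nndist_self t)
  refine squeeze_zero (fun _ => dist_nonneg) (fun s => ?_) (hkk.comp hnn)
  rcases le_total t s with h | h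
  · simpa only [Function.comp, dist_comm, nndist_comm] using hdist_of_le h
  · exact hdist_of_le h

end IsMarkovChain

theorem hasDerivWithinAt_of_abs_sub_le {f e r : ℝ → ℝ} {e' x : ℝ} {s : Set ℝ} (hx : x ∈ s)
    (he : HasDerivWithinAt e e' s x) (hr : HasDerivWithinAt r 0 s x) (hrx : r x = 0)
    (hle : ∀ y ∈ s, |f y - e y| ≤ r y) : HasDerivWithinAt f e' s x := by
  have hfx : f x - e x = 0 := abs_nonpos_iff.1 ((hle x hx).trans_eq hrx)
  have hsub : HasDerivWithinAt (fun y => f y - e y) 0 s x := by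
    rw [hasDerivWithinAt_iff_isLittleO] at hr ⊢
    refine Asymptotics.IsBigO.trans_isLittleO (Asymptotics.IsBigO.of_bound 1 ?_) hr
    filter_upwards [self_mem_nhdsWithin] with y hy
    simpa [hfx, hrx] using (hle y hy).trans (le_abs_self _)
  exact ((he.fun_add hsub).congr_deriv (add_zero e')).congr_of_eventuallyEq
    (Eventually.of_forall fun y => (add_sub_cancel _ _).symm) (add_sub_cancel _ _).symm

/-- Kolmogorov's backward equation. -/
theorem IsMarkovChain.hasDerivWithinAt_stateProb {g : ℤ → ℤ → ℝ} (hX : IsMarkovChain P X)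
    (hG : HasGenerator P X g) {S : Finset ℤ} {k : ℤ} (hk : k ∈ S) (hS : ∑ j ∈ S, g k j = 0)
    (n : ℤ) {t : ℝ} (ht : 0 ≤ t) :
    HasDerivWithinAt (fun y : ℝ => stateProb P X k n y.toNNReal)
      (∑ j ∈ S, g k j * stateProb P X j n t.toNNReal) (Set.Ici t) t := by
  have hshift : HasDerivWithinAt (fun y => y - t) 1 (Set.Ici t) t :=
    (hasDerivWithinAt_id t _).sub_const t
  have hp (j : ℤ) : HasDerivWithinAt (fun y : ℝ => stateProb P X k j (y - t).toNNReal) (g k j)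
      (Set.Ici t) t := by
    simpa [Function.comp_def] using HasDerivWithinAt.comp_of_eq t (hG.hasDerivWithinAt_zero k j)
      hshift (fun y hy => Set.mem_Ici.2 (sub_nonneg.2 hy)) (sub_self t).symm
  have hsum := HasDerivWithinAt.fun_sum fun j (_ : j ∈ S) =>
    (hp j).mul_const (stateProb P X j n t.toNNReal)
  have hrest := (HasDerivWithinAt.fun_sum fun j (_ : j ∈ S) => hp j).const_sub 1
  rw [hS, neg_zero] at hrest
  refine hasDerivWithinAt_of_abs_sub_le Set.self_mem_Ici hsum hrest ?_ fun y hy => ?_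
  · simp [hX.stateProb_zero, hk]
  · have hadd : y.toNNReal = (y - t).toNNReal + t.toNNReal := by
      rw [← Real.toNNReal_add (sub_nonneg.2 hy) ht, sub_add_cancel]
    obtain ⟨hl, hu⟩ := hX.stateProb_add_sub_sum_mem_Icc S k n (y - t).toNNReal t.toNNReal
    rw [hadd, abs_of_nonneg hl]
    exact hu

end Chain

/-! ### Expectations of eigenfunctions of the generator -/

section Gronwall

variable {ι E : Type*} [NormedAddCommGroup E] [NormedSpace ℝ E] {g : ι → ι → ℝ} {S : ι → Finset ι}
  {d : ι → ℝ → E} {W : ι → ℝ} {K T : ℝ}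

theorem norm_le_mul_weight_of_hasDerivAt {φ B : ℝ → ℝ} (hW : ∀ k, 0 < W k)
    (hgW : ∀ k, ∑ j ∈ S k, |g k j| * W j ≤ K * W k)
    (hc : ∀ k, ContinuousOn (d k) (Set.Icc 0 T))
    (hd : ∀ k, ∀ t ∈ Set.Ico 0 T,
      HasDerivWithinAt (d k) (∑ j ∈ S k, g k j • d j t) (Set.Ici t) t)
    (hφ : ∀ k, ∀ t ∈ Set.Icc 0 T, ‖d k t‖ ≤ φ t * W k) (hB : ∀ t, HasDerivAt B (K * φ t) t)
    (h0 : ∀ k, ‖d k 0‖ ≤ B 0 * W k) (k : ι) {t : ℝ} (ht : t ∈ Set.Icc 0 T) :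
    ‖d k t‖ ≤ B t * W k := by
  refine image_norm_le_of_norm_deriv_right_le_deriv_boundary (hc k) (hd k) (h0 k)
    (fun x => (hB x).mul_const (W k)) (fun x hx => ?_) ht
  have hx' : x ∈ Set.Icc 0 T := Set.Ico_subset_Icc_self hx
  have hφx : 0 ≤ φ x := nonneg_of_mul_nonneg_left ((norm_nonneg _).trans (hφ k x hx')) (hW k)
  calc ‖∑ j ∈ S k, g k j • d j x‖ ≤ ∑ j ∈ S k, φ x * (|g k j| * W j) := by
        refine norm_sum_le_of_le _ fun j _ => ?_
        rw [norm_smul, Real.norm_eq_abs, mul_left_comm]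
        exact mul_le_mul_of_nonneg_left (hφ j x hx') (abs_nonneg _)
    _ ≤ φ x * (K * W k) := by
        rw [← Finset.mul_sum]
        exact mul_le_mul_of_nonneg_left (hgW k) hφx
    _ = K * φ x * W k := by ring

theorem hasDerivAt_mul_exp_add_mul_pow_div_factorial (K M ε : ℝ) (n : ℕ) (t : ℝ) :
    HasDerivAt (fun t => ε * Real.exp (K * t) + M * ((K * t) ^ (n + 1) / (n + 1).factorial))
      (K * (ε * Real.exp (K * t) + M * ((K * t) ^ n / n.factorial))) t := by
  have hKt : HasDerivAt (fun t => K * t) K t := hasDerivAt_const_mul K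
  refine ((hKt.exp.const_mul ε).add
    (((hKt.fun_pow (n + 1)).div_const ((n + 1).factorial : ℝ)).const_mul M)).congr_deriv ?_
  have : (n.factorial : ℝ) ≠ 0 := by positivity
  simp only [Nat.factorial_succ, Nat.add_sub_cancel]
  push_cast
  field_simp

/-- Since `ι` may be infinite, there is no norm to apply the usual Grönwall inequality to: the
a priori bound `M` is improved by iterating the integral inequality. -/
theorem norm_le_mul_exp_of_hasDerivWithinAt_sum {ε M : ℝ} (hW : ∀ k, 0 < W k)
    (hgW : ∀ k, ∑ j ∈ S k, |g k j| * W j ≤ K * W k)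
    (hc : ∀ k, ContinuousOn (d k) (Set.Icc 0 T))
    (hd : ∀ k, ∀ t ∈ Set.Ico 0 T,
      HasDerivWithinAt (d k) (∑ j ∈ S k, g k j • d j t) (Set.Ici t) t)
    (h0 : ∀ k, ‖d k 0‖ ≤ ε * W k) (hM : ∀ k, ∀ t ∈ Set.Icc 0 T, ‖d k t‖ ≤ M * W k)
    (k : ι) {t : ℝ} (ht : t ∈ Set.Icc 0 T) :
    ‖d k t‖ ≤ ε * Real.exp (K * t) * W k := by
  have hε : 0 ≤ ε := nonneg_of_mul_nonneg_left ((norm_nonneg _).trans (h0 k)) (hW k)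
  have hiter (n : ℕ) : ∀ k, ∀ t ∈ Set.Icc 0 T,
      ‖d k t‖ ≤ (ε * Real.exp (K * t) + M * ((K * t) ^ n / n.factorial)) * W k := by
    induction n with
    | zero =>
      intro k t ht
      refine (hM k t ht).trans (mul_le_mul_of_nonneg_right ?_ (hW k).le)
      have : 0 ≤ ε * Real.exp (K * t) := by positivity
      simpa using this
    | succ n ih =>
      intro k t ht
      exact norm_le_mul_weight_of_hasDerivAt hW hgW hc hd ih
        (hasDerivAt_mul_exp_add_mul_pow_div_factorial K M ε n) (by simpa using h0) k ht
  have hlim : Tendsto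
      (fun n : ℕ => (ε * Real.exp (K * t) + M * ((K * t) ^ n / n.factorial)) * W k)
      atTop (𝓝 ((ε * Real.exp (K * t) + M * 0) * W k)) :=
    (((FloorSemiring.tendsto_pow_div_factorial_atTop (K * t)).const_mul M).const_add _).mul_const _
  rw [mul_zero, add_zero] at hlim
  exact ge_of_tendsto' hlim fun n => hiter n k t ht

end Gronwall

section Eigenfunction

variable {Ω : Type*} [MeasurableSpace Ω] {P : ℤ → Measure Ω} {X : ℝ≥0 → Ω → ℤ}
  {g : ℤ → ℤ → ℝ} {S : ℤ → Finset ℤ} {f W : ℤ → ℝ} {K lam : ℝ}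

/-- For an eigenfunction `f` of the generator with eigenvalue `lam`, the difference between the
expected value `e^{lam y} f(k)` of `f (X y)` and the part of the expectation carried by the finite
set `F` of states. -/
noncomputable def truncationError (P : ℤ → Measure Ω) (X : ℝ≥0 → Ω → ℤ) (f : ℤ → ℝ) (lam : ℝ)
    (F : Finset ℤ) (k : ℤ) (y : ℝ) : ℝ :=
  Real.exp (lam * y) * f k - ∑ n ∈ F, f n * stateProb P X k n y.toNNReal

namespace IsMarkovChain

theorem truncationError_zero (hX : IsMarkovChain P X) (F : Finset ℤ) (k : ℤ) :
    truncationError P X f lam F k 0 = if k ∈ F then 0 else f k := by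
  simp only [truncationError, mul_zero, Real.exp_zero, one_mul, Real.toNNReal_zero,
    hX.stateProb_zero, mul_ite, mul_one, Finset.sum_ite_eq']
  split_ifs <;> simp

theorem abs_truncationError_le (hX : IsMarkovChain P X) (F : Finset ℤ) (k : ℤ) {y T : ℝ}
    (hy : y ∈ Set.Icc 0 T) :
    |truncationError P X f lam F k y| ≤ Real.exp (|lam| * T) * |f k| + ∑ n ∈ F, |f n| := by
  refine (abs_sub _ _).trans (add_le_add ?_ ?_)
  · rw [abs_mul, Real.abs_exp]
    gcongr
    · exact hy.1
    · exact le_abs_self lam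
    · exact hy.2
  · refine (Finset.abs_sum_le_sum_abs _ _).trans (Finset.sum_le_sum fun n _ => ?_)
    rw [abs_mul, abs_of_nonneg (stateProb_nonneg k n _)]
    exact mul_le_of_le_one_right (abs_nonneg _) (hX.stateProb_le_one k n _)

theorem continuous_truncationError (hX : IsMarkovChain P X) (hG : HasGenerator P X g)
    (F : Finset ℤ) (k : ℤ) : Continuous (truncationError P X f lam F k) :=
  (by fun_prop : Continuous fun y : ℝ => Real.exp (lam * y) * f k).sub <|
    continuous_finsetSum _ fun n _ => continuous_const.mul
      ((hX.continuous_stateProb hG k n).comp continuous_real_toNNReal)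

theorem hasDerivWithinAt_truncationError (hX : IsMarkovChain P X) (hG : HasGenerator P X g)
    (hmem : ∀ k, k ∈ S k) (hS : ∀ k, ∑ j ∈ S k, g k j = 0)
    (heig : ∀ k, ∑ j ∈ S k, g k j * f j = lam * f k) (F : Finset ℤ) (k : ℤ) {y : ℝ} (hy : 0 ≤ y) :
    HasDerivWithinAt (truncationError P X f lam F k)
      (∑ j ∈ S k, g k j * truncationError P X f lam F j y) (Set.Ici y) y := by
  have hexp : HasDerivAt (fun y => Real.exp (lam * y) * f k) (Real.exp (lam * y) * lam * f k) y :=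
    (hasDerivAt_const_mul lam).exp.mul_const (f k)
  have hsum := HasDerivWithinAt.fun_sum fun n (_ : n ∈ F) =>
    (hX.hasDerivWithinAt_stateProb hG (hmem k) (hS k) n hy).const_mul (f n)
  refine (hexp.hasDerivWithinAt.fun_sub hsum).congr_deriv ?_
  simp only [truncationError, mul_sub, Finset.sum_sub_distrib, Finset.mul_sum]
  rw [Finset.sum_comm, mul_assoc, ← heig k, Finset.mul_sum]
  simp only [mul_left_comm]

theorem abs_truncationError_le_of_forall_notMem (hX : IsMarkovChain P X) (hG : HasGenerator P X g)
    (hmem : ∀ k, k ∈ S k) (hS : ∀ k, ∑ j ∈ S k, g k j = 0) (hW : ∀ k, 1 ≤ W k)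
    (hgW : ∀ k, ∑ j ∈ S k, |g k j| * W j ≤ K * W k)
    (heig : ∀ k, ∑ j ∈ S k, g k j * f j = lam * f k) {C ε : ℝ} (hfC : ∀ k, |f k| ≤ C * W k)
    (hε : 0 ≤ ε) {F : Finset ℤ} (hF : ∀ k ∉ F, |f k| ≤ ε * W k) (k : ℤ) {t : ℝ} (ht : 0 ≤ t) :
    |truncationError P X f lam F k t| ≤ ε * Real.exp (K * t) * W k := by
  have hW0 (k : ℤ) : 0 < W k := one_pos.trans_le (hW k)
  refine norm_le_mul_exp_of_hasDerivWithinAt_sum (T := t)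
    (M := Real.exp (|lam| * t) * C + ∑ n ∈ F, |f n|) hW0 hgW
    (fun k => (hX.continuous_truncationError hG F k).continuousOn)
    (fun k y hy => hX.hasDerivWithinAt_truncationError hG hmem hS heig F k hy.1)
    (fun k => ?_) (fun k y hy => ?_) k ⟨ht, le_rfl⟩
  · rw [hX.truncationError_zero, Real.norm_eq_abs]
    split_ifs with hk
    · simpa using mul_nonneg hε (hW0 k).le
    · exact hF k hk
  · refine (hX.abs_truncationError_le F k hy).trans ?_
    rw [add_mul, mul_assoc]
    gcongr
    · exact hfC k
    · exact le_mul_of_one_le_right (Finset.sum_nonneg fun n _ => abs_nonneg _) (hW k)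

/-- The backward equation alone does not determine expectations of unbounded functions; the weight
`W`, which dominates `f` at infinity, provides the uniqueness. -/
theorem hasSum_mul_stateProb_of_eigenfunction (hX : IsMarkovChain P X) (hG : HasGenerator P X g)
    (hmem : ∀ k, k ∈ S k) (hS : ∀ k, ∑ j ∈ S k, g k j = 0) (hW : ∀ k, 1 ≤ W k)
    (hgW : ∀ k, ∑ j ∈ S k, |g k j| * W j ≤ K * W k) (hfW : f =o[cofinite] W)
    (heig : ∀ k, ∑ j ∈ S k, g k j * f j = lam * f k) (k : ℤ) (t : ℝ≥0) :
    HasSum (fun n => f n * stateProb P X k n t) (Real.exp (lam * t) * f k) := by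
  have hW0 (k : ℤ) : 0 < W k := one_pos.trans_le (hW k)
  obtain ⟨C, hC⟩ := (Asymptotics.isBigO_cofinite_iff fun n hn => absurd hn (hW0 n).ne').1 hfW.isBigO
  have hfC (n : ℤ) : |f n| ≤ C * W n := by simpa [abs_of_pos (hW0 n)] using hC n
  refine Metric.tendsto_atTop.2 fun δ hδ => ?_
  set ε := δ / (2 * (Real.exp (K * t) * W k))
  have hε : 0 < ε := div_pos hδ (mul_pos two_pos (mul_pos (Real.exp_pos _) (hW0 k)))
  have hfin : {n | ¬ ‖f n‖ ≤ ε * ‖W n‖}.Finite := eventually_cofinite.1 (hfW.bound hε)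
  refine ⟨hfin.toFinset, fun F hF => ?_⟩
  have hF' : ∀ n ∉ F, |f n| ≤ ε * W n := fun n hn => by
    have h : ‖f n‖ ≤ ε * ‖W n‖ := by_contra fun h => hn (hF (hfin.mem_toFinset.2 h))
    rwa [Real.norm_of_nonneg (hW0 n).le] at h
  calc dist (∑ n ∈ F, f n * stateProb P X k n t) (Real.exp (lam * t) * f k)
      = |truncationError P X f lam F k t| := by
        rw [dist_comm, Real.dist_eq, truncationError, Real.toNNReal_coe]
    _ ≤ ε * Real.exp (K * t) * W k :=
        hX.abs_truncationError_le_of_forall_notMem hG hmem hS hW hgW heig hfC hε.le hF' k t.2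
    _ = δ / 2 := by
        have := (hW0 k).ne'
        simp only [ε]
        field_simp
    _ < δ := half_lt_self hδ

theorem integrable_and_integral_eq_of_hasSum (hX : IsMarkovChain P X) {k : ℤ} {t : ℝ≥0} {a : ℝ}
    (h : HasSum (fun n => f n * stateProb P X k n t) a) :
    Integrable (fun ω => f (X t ω)) (P k) ∧ ∫ ω, f (X t ω) ∂(P k) = a := by
  have := hX.isProbabilityMeasure k
  have hf (μ : Measure ℤ) : AEStronglyMeasurable f μ :=
    (measurable_of_countable f).aestronglyMeasurable
  have hlaw (n : ℤ) : ((P k).map (X t)).real {n} = stateProb P X k n t :=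
    map_measureReal_apply (hX.measurable t) (measurableSet_singleton n)
  have hint : Integrable f ((P k).map (X t)) := by
    rw [← Measure.sum_smul_dirac ((P k).map (X t))]
    refine integrable_sum_dirac (fun n => measure_ne_top _ _) ?_
    simpa [← measureReal_def, hlaw, abs_mul, mul_comm, abs_of_nonneg (stateProb_nonneg k _ t)]
      using h.summable.abs
  refine ⟨hint.comp_measurable (hX.measurable t), ?_⟩
  rw [← integral_map (hX.measurable t).aemeasurable (hf _), integral_countable hint, ← h.tsum_eq]
  simp only [hlaw, smul_eq_mul, mul_comm]

end IsMarkovChain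

end Eigenfunction

/-! ### The function `Λ` -/

section Lambda

variable {α₁ α₂ β₁ β₂ : ℝ}

/-- The rates of an alternating chain that is not confined to a pair of neighbouring states: two
consecutive jumps in the same direction are possible. -/
structure UnconfinedRates (α₁ α₂ β₁ β₂ : ℝ) : Prop where
  α₁_nonneg : 0 ≤ α₁
  α₂_nonneg : 0 ≤ α₂
  β₁_nonneg : 0 ≤ β₁
  β₂_nonneg : 0 ≤ β₂
  pos : 0 < α₁ * β₁ + α₂ * β₂

/-- The exponentially tilted total jump rate from a state with rate `p` to the right and `q` to the
left: jumps to the right are weighted by `e^γ`, jumps to the left by `e^{-γ}`. -/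
noncomputable def tiltedRate (p q γ : ℝ) : ℝ :=
  p * Real.exp γ + q * Real.exp (-γ)

@[simp]
theorem tiltedRate_zero (p q : ℝ) : tiltedRate p q 0 = p + q := by
  simp [tiltedRate]

@[fun_prop]
theorem contDiff_tiltedRate {n : WithTop ℕ∞} (p q : ℝ) : ContDiff ℝ n (tiltedRate p q) := by
  unfold tiltedRate
  fun_prop

theorem hasDerivAt_tiltedRate (p q γ : ℝ) :
    HasDerivAt (tiltedRate p q) (tiltedRate p (-q) γ) γ :=
  (((Real.hasDerivAt_exp γ).const_mul p).add ((hasDerivAt_neg γ).exp.const_mul q)).congr_deriv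
    (by rw [tiltedRate]; ring)

theorem LambdaFun_eq (α₁ α₂ β₁ β₂ γ : ℝ) :
    LambdaFun α₁ α₂ β₁ β₂ γ = (√((α₁ + α₂ - (β₁ + β₂)) ^ 2 +
      4 * (tiltedRate α₁ α₂ γ * tiltedRate β₁ β₂ γ)) - (α₁ + α₂ + β₁ + β₂)) / 2 := by
  have hexp := Real.exp_pos γ
  have h : hTilde α₁ α₂ β₁ β₂ (Real.exp γ) = Real.exp γ ^ 2 * ((α₁ + α₂ - (β₁ + β₂)) ^ 2 +
      4 * (tiltedRate α₁ α₂ γ * tiltedRate β₁ β₂ γ)) := by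
    rw [hTilde, tiltedRate, tiltedRate, Real.exp_neg]
    field_simp
  rw [LambdaFun, hFun, h, Real.sqrt_mul (sq_nonneg _), Real.sqrt_sq hexp.le]
  field_simp

theorem isLittleO_sub_taylor_two {f : ℝ → ℝ} (hf : ContDiff ℝ 2 f) (x₀ : ℝ) :
    (fun x => f x - f x₀ - deriv f x₀ * (x - x₀) - deriv (deriv f) x₀ * (x - x₀) ^ 2 / 2)
      =o[𝓝 x₀] fun x => (x - x₀) ^ 2 := by
  refine (taylor_isLittleO_univ (x₀ := x₀) hf).congr_left fun x => ?_
  rw [taylorWithinEval_succ, taylorWithinEval_succ, taylor_within_zero_eval,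
    iteratedDerivWithin_univ, iteratedDerivWithin_univ, zero_add, iteratedDeriv_succ (n := 1),
    iteratedDeriv_one]
  simp only [smul_eq_mul]
  norm_num
  ring

namespace UnconfinedRates

theorem symm (h : UnconfinedRates α₁ α₂ β₁ β₂) : UnconfinedRates β₁ β₂ α₁ α₂ where
  α₁_nonneg := h.β₁_nonneg
  α₂_nonneg := h.β₂_nonneg
  β₁_nonneg := h.α₁_nonneg
  β₂_nonneg := h.α₂_nonneg
  pos := by simpa only [mul_comm] using h.pos

theorem tiltedRate_pos (h : UnconfinedRates α₁ α₂ β₁ β₂) (γ : ℝ) : 0 < tiltedRate α₁ α₂ γ := by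
  have hα : α₁ ≠ 0 ∨ α₂ ≠ 0 := by
    by_contra! hα
    simpa [hα.1, hα.2] using h.pos
  rcases hα with hα | hα
  · exact add_pos_of_pos_of_nonneg (mul_pos (h.α₁_nonneg.lt_of_ne' hα) (Real.exp_pos _))
      (mul_nonneg h.α₂_nonneg (Real.exp_pos _).le)
  · exact add_pos_of_nonneg_of_pos (mul_nonneg h.α₁_nonneg (Real.exp_pos _).le)
      (mul_pos (h.α₂_nonneg.lt_of_ne' hα) (Real.exp_pos _))

theorem sum_rates_pos (h : UnconfinedRates α₁ α₂ β₁ β₂) : 0 < α₁ + α₂ + β₁ + β₂ := by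
  have hα := h.tiltedRate_pos 0
  have hβ := h.symm.tiltedRate_pos 0
  rw [tiltedRate_zero] at hα hβ
  linarith

theorem sq_sub_lt_radicand (h : UnconfinedRates α₁ α₂ β₁ β₂) (γ : ℝ) :
    (α₁ + α₂ - (β₁ + β₂)) ^ 2 < (α₁ + α₂ - (β₁ + β₂)) ^ 2 +
      4 * (tiltedRate α₁ α₂ γ * tiltedRate β₁ β₂ γ) :=
  lt_add_of_pos_right _ (by linarith [mul_pos (h.tiltedRate_pos γ) (h.symm.tiltedRate_pos γ)])

/-- `Λ(γ)` is an eigenvalue of the matrix of tilted rates of the parity of the chain. -/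
theorem LambdaFun_characteristic (h : UnconfinedRates α₁ α₂ β₁ β₂) (γ : ℝ) :
    (LambdaFun α₁ α₂ β₁ β₂ γ + (α₁ + α₂)) * (LambdaFun α₁ α₂ β₁ β₂ γ + (β₁ + β₂)) =
      tiltedRate α₁ α₂ γ * tiltedRate β₁ β₂ γ := by
  have hsqrt := Real.sq_sqrt ((sq_nonneg _).trans (h.sq_sub_lt_radicand γ).le)
  rw [LambdaFun_eq]
  linear_combination hsqrt / 4

theorem LambdaFun_zero (h : UnconfinedRates α₁ α₂ β₁ β₂) : LambdaFun α₁ α₂ β₁ β₂ 0 = 0 := by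
  have hsq : (α₁ + α₂ - (β₁ + β₂)) ^ 2 + 4 * ((α₁ + α₂) * (β₁ + β₂)) =
      (α₁ + α₂ + β₁ + β₂) ^ 2 := by ring
  rw [LambdaFun_eq, tiltedRate_zero, tiltedRate_zero, hsq, Real.sqrt_sq h.sum_rates_pos.le,
    sub_self, zero_div]

theorem contDiff_LambdaFun (h : UnconfinedRates α₁ α₂ β₁ β₂) {n : WithTop ℕ∞} :
    ContDiff ℝ n (LambdaFun α₁ α₂ β₁ β₂) := by
  rw [funext (LambdaFun_eq α₁ α₂ β₁ β₂)]
  refine ((ContDiff.sqrt ?_ fun γ =>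
    ((sq_nonneg _).trans_lt (h.sq_sub_lt_radicand γ)).ne').sub contDiff_const).div_const 2
  fun_prop

theorem deriv_LambdaFun_mul (h : UnconfinedRates α₁ α₂ β₁ β₂) (γ : ℝ) :
    deriv (LambdaFun α₁ α₂ β₁ β₂) γ * (2 * LambdaFun α₁ α₂ β₁ β₂ γ + (α₁ + α₂ + β₁ + β₂)) =
      2 * tiltedRate (α₁ * β₁) (-(α₂ * β₂)) (2 * γ) := by
  have hΛ := ((h.contDiff_LambdaFun (n := 1)).differentiable one_ne_zero γ).hasDerivAt
  have hleft := (hΛ.add_const (α₁ + α₂)).mul (hΛ.add_const (β₁ + β₂))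
  have hright := (hasDerivAt_tiltedRate α₁ α₂ γ).mul (hasDerivAt_tiltedRate β₁ β₂ γ)
  have heq := hleft.unique
    (hright.congr_of_eventuallyEq (Eventually.of_forall h.LambdaFun_characteristic))
  have hexp : Real.exp γ * Real.exp γ = Real.exp (2 * γ) := by rw [← Real.exp_add, two_mul]
  have hexp' : Real.exp (-γ) * Real.exp (-γ) = Real.exp (-(2 * γ)) := by
    rw [← Real.exp_add]; ring_nf
  simp only [tiltedRate] at heq ⊢
  linear_combination heq + 2 * α₁ * β₁ * hexp - 2 * α₂ * β₂ * hexp'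

theorem LambdaSecond_mul (h : UnconfinedRates α₁ α₂ β₁ β₂) :
    LambdaSecond α₁ α₂ β₁ β₂ * (α₁ + α₂ + β₁ + β₂) +
      2 * deriv (LambdaFun α₁ α₂ β₁ β₂) 0 ^ 2 = 4 * (α₁ * β₁ + α₂ * β₂) := by
  have hΛ := ((h.contDiff_LambdaFun (n := 2)).differentiable two_ne_zero 0).hasDerivAt
  have hΛ' := ((h.contDiff_LambdaFun (n := 2)).differentiable_deriv_two 0).hasDerivAt
  have hleft := hΛ'.mul ((hΛ.const_mul 2).add_const (α₁ + α₂ + β₁ + β₂))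
  have hright := ((HasDerivAt.comp 0 (hasDerivAt_tiltedRate (α₁ * β₁) (-(α₂ * β₂)) (2 * 0))
    (hasDerivAt_const_mul 2)).const_mul 2)
  have heq := hleft.unique
    (hright.congr_of_eventuallyEq (Eventually.of_forall h.deriv_LambdaFun_mul))
  simp only [h.LambdaFun_zero, mul_zero, tiltedRate_zero] at heq
  rw [LambdaSecond]
  linear_combination heq

theorem LambdaSecond_pos (h : UnconfinedRates α₁ α₂ β₁ β₂) : 0 < LambdaSecond α₁ α₂ β₁ β₂ := by
  have hs := h.sum_rates_pos
  have hfirst := h.deriv_LambdaFun_mul 0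
  have hsecond := h.LambdaSecond_mul
  rw [h.LambdaFun_zero, mul_zero, zero_add, tiltedRate_zero] at hfirst
  set s := α₁ + α₂ + β₁ + β₂
  set p := α₁ * β₁
  set q := α₂ * β₂
  have hp : 0 ≤ p := mul_nonneg h.α₁_nonneg h.β₁_nonneg
  have hq : 0 ≤ q := mul_nonneg h.α₂_nonneg h.β₂_nonneg
  have hpq : 4 * (p + q) ≤ s ^ 2 := by
    nlinarith [sq_nonneg (α₁ - β₁), sq_nonneg (α₂ - β₂), mul_nonneg
      (add_nonneg h.α₁_nonneg h.β₁_nonneg) (add_nonneg h.α₂_nonneg h.β₂_nonneg)]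
  have hmul : LambdaSecond α₁ α₂ β₁ β₂ * s ^ 3 = 4 * (p + q) * s ^ 2 - 8 * (p - q) ^ 2 := by
    linear_combination s ^ 2 * hsecond -
      2 * (deriv (LambdaFun α₁ α₂ β₁ β₂) 0 * s + 2 * (p - q)) * hfirst
  refine pos_of_mul_pos_left (lt_of_lt_of_eq ?_ hmul.symm) (by positivity)
  have := mul_le_mul_of_nonneg_left hpq h.pos.le
  nlinarith [h.pos, mul_pos h.pos h.pos, mul_nonneg hp hq]

theorem LambdaFun_sub_isLittleO (h : UnconfinedRates α₁ α₂ β₁ β₂) :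
    (fun γ => LambdaFun α₁ α₂ β₁ β₂ γ - deriv (LambdaFun α₁ α₂ β₁ β₂) 0 * γ -
      LambdaSecond α₁ α₂ β₁ β₂ * γ ^ 2 / 2) =o[𝓝 0] fun γ => γ ^ 2 := by
  simpa [h.LambdaFun_zero, LambdaSecond] using isLittleO_sub_taylor_two h.contDiff_LambdaFun 0

end UnconfinedRates

end Lambda

/-! ### Exponential moments of the alternating chain -/

section AlternatingChain

variable {Ω : Type*} [MeasurableSpace Ω] {P : ℤ → Measure Ω} {X : ℝ≥0 → Ω → ℤ}
  {α₁ α₂ β₁ β₂ : ℝ}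

theorem alternatingGenerator_add_one (α₁ α₂ β₁ β₂ : ℝ) (k : ℤ) :
    alternatingGenerator α₁ α₂ β₁ β₂ k (k + 1) = if Even k then α₁ else β₁ :=
  if_pos rfl

theorem alternatingGenerator_sub_one (α₁ α₂ β₁ β₂ : ℝ) (k : ℤ) :
    alternatingGenerator α₁ α₂ β₁ β₂ k (k - 1) = if Even k then α₂ else β₂ := by
  rw [alternatingGenerator, if_neg (by omega), if_pos rfl]

theorem alternatingGenerator_self (α₁ α₂ β₁ β₂ : ℝ) (k : ℤ) :
    alternatingGenerator α₁ α₂ β₁ β₂ k k = if Even k then -(α₁ + α₂) else -(β₁ + β₂) := by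
  rw [alternatingGenerator, if_neg (by omega), if_neg (by omega), if_pos rfl]

theorem sum_sub_one_self_add_one {M : Type*} [AddCommMonoid M] (k : ℤ) (F : ℤ → M) :
    ∑ j ∈ ({k - 1, k, k + 1} : Finset ℤ), F j = F (k - 1) + F k + F (k + 1) := by
  rw [Finset.sum_insert (by grind), Finset.sum_insert (by simp), Finset.sum_singleton, add_assoc]

theorem sum_alternatingGenerator_mul (α₁ α₂ β₁ β₂ : ℝ) (k : ℤ) (F : ℤ → ℝ) :
    ∑ j ∈ {k - 1, k, k + 1}, alternatingGenerator α₁ α₂ β₁ β₂ k j * F j =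
      if Even k then α₁ * F (k + 1) + α₂ * F (k - 1) - (α₁ + α₂) * F k
      else β₁ * F (k + 1) + β₂ * F (k - 1) - (β₁ + β₂) * F k := by
  rw [sum_sub_one_self_add_one, alternatingGenerator_sub_one, alternatingGenerator_self,
    alternatingGenerator_add_one]
  split_ifs <;> ring

theorem IsMarkovChain.unconfinedRates (hX : IsMarkovChain P X)
    (hG : HasGenerator P X (alternatingGenerator α₁ α₂ β₁ β₂)) (h : α₁ * β₁ + α₂ * β₂ ≠ 0) :
    UnconfinedRates α₁ α₂ β₁ β₂ := by
  have hright (k : ℤ) := hX.generator_nonneg hG (show k + 1 ≠ k by omega)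
  have hleft (k : ℤ) := hX.generator_nonneg hG (show k - 1 ≠ k by omega)
  simp only [alternatingGenerator_add_one] at hright
  simp only [alternatingGenerator_sub_one] at hleft
  have hα₁ : 0 ≤ α₁ := by simpa using hright 0
  have hα₂ : 0 ≤ α₂ := by simpa using hleft 0
  have hβ₁ : 0 ≤ β₁ := by simpa using hright 1
  have hβ₂ : 0 ≤ β₂ := by simpa using hleft 1
  exact ⟨hα₁, hα₂, hβ₁, hβ₂, lt_of_le_of_ne' (by positivity) h⟩

/-- The eigenvector, for the eigenvalue `Λ(γ)`, of the tilted generator of the parity of the chain,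
viewed as a function on `ℤ`; thus `e^{γn}` times it is an eigenfunction of the generator. -/
noncomputable def tiltedEigenvector (α₁ α₂ β₁ β₂ γ : ℝ) (n : ℤ) : ℝ :=
  if Even n then tiltedRate α₁ α₂ γ else LambdaFun α₁ α₂ β₁ β₂ γ + (α₁ + α₂)

namespace UnconfinedRates

theorem sum_alternatingGenerator_mul_exp_mul_tiltedEigenvector (h : UnconfinedRates α₁ α₂ β₁ β₂)
    (γ : ℝ) (k : ℤ) :
    ∑ j ∈ {k - 1, k, k + 1}, alternatingGenerator α₁ α₂ β₁ β₂ k j *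
        (Real.exp (γ * j) * tiltedEigenvector α₁ α₂ β₁ β₂ γ j) =
      LambdaFun α₁ α₂ β₁ β₂ γ * (Real.exp (γ * k) * tiltedEigenvector α₁ α₂ β₁ β₂ γ k) := by
  have hchar := h.LambdaFun_characteristic γ
  have hadd : Real.exp (γ * (k + 1 : ℤ)) = Real.exp (γ * k) * Real.exp γ := by
    rw [← Real.exp_add]; push_cast; ring_nf
  have hsub : Real.exp (γ * (k - 1 : ℤ)) = Real.exp (γ * k) * Real.exp (-γ) := by
    rw [← Real.exp_add]; push_cast; ring_nf
  rw [sum_alternatingGenerator_mul, hadd, hsub]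
  simp only [tiltedEigenvector, Int.even_add_one, Int.even_sub_one]
  split_ifs <;> simp only [tiltedRate] at *
  · ring
  · linear_combination -Real.exp (γ * k) * hchar

theorem sum_abs_alternatingGenerator_mul_exp_abs_le (h : UnconfinedRates α₁ α₂ β₁ β₂) {c : ℝ}
    (hc : 0 ≤ c) (k : ℤ) :
    ∑ j ∈ {k - 1, k, k + 1}, |alternatingGenerator α₁ α₂ β₁ β₂ k j| * Real.exp (c * |(j : ℝ)|) ≤
      2 * (α₁ + α₂ + β₁ + β₂) * Real.exp c * Real.exp (c * |(k : ℝ)|) := by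
  have hrates : ∑ j ∈ {k - 1, k, k + 1}, |alternatingGenerator α₁ α₂ β₁ β₂ k j| ≤
      2 * (α₁ + α₂ + β₁ + β₂) := by
    obtain ⟨hα₁, hα₂, hβ₁, hβ₂, -⟩ := h
    rw [sum_sub_one_self_add_one, alternatingGenerator_sub_one, alternatingGenerator_self,
      alternatingGenerator_add_one]
    split_ifs <;> rw [abs_neg, abs_of_nonneg, abs_of_nonneg, abs_of_nonneg] <;> linarith
  have hexp : ∀ j ∈ ({k - 1, k, k + 1} : Finset ℤ),
      Real.exp (c * |(j : ℝ)|) ≤ Real.exp c * Real.exp (c * |(k : ℝ)|) := fun j hj => by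
    have hjk : |(j : ℝ)| ≤ |(k : ℝ)| + 1 := by
      have : |j| ≤ |k| + 1 := by
        simp only [Finset.mem_insert, Finset.mem_singleton] at hj
        rcases hj with rfl | rfl | rfl
        · simpa using abs_sub k 1
        · simp
        · simpa using abs_add_le k 1
      exact_mod_cast this
    rw [← Real.exp_add, Real.exp_le_exp]
    linarith [mul_le_mul_of_nonneg_left hjk hc]
  calc ∑ j ∈ {k - 1, k, k + 1}, |alternatingGenerator α₁ α₂ β₁ β₂ k j| * Real.exp (c * |(j : ℝ)|)
      ≤ ∑ j ∈ {k - 1, k, k + 1}, |alternatingGenerator α₁ α₂ β₁ β₂ k j| *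
          (Real.exp c * Real.exp (c * |(k : ℝ)|)) :=
        Finset.sum_le_sum fun j hj => mul_le_mul_of_nonneg_left (hexp j hj) (abs_nonneg _)
    _ ≤ 2 * (α₁ + α₂ + β₁ + β₂) * Real.exp c * Real.exp (c * |(k : ℝ)|) := by
        rw [← Finset.sum_mul, mul_assoc _ (Real.exp c)]
        exact mul_le_mul_of_nonneg_right hrates (by positivity)

end UnconfinedRates

theorem isLittleO_exp_mul_tiltedEigenvector (α₁ α₂ β₁ β₂ γ : ℝ) :
    (fun n : ℤ => Real.exp (γ * n) * tiltedEigenvector α₁ α₂ β₁ β₂ γ n) =o[cofinite]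
      fun n : ℤ => Real.exp ((|γ| + 1) * |(n : ℝ)|) := by
  have hvector : tiltedEigenvector α₁ α₂ β₁ β₂ γ =O[cofinite] fun _ => (1 : ℝ) := by
    refine .of_bound (max |tiltedRate α₁ α₂ γ| |LambdaFun α₁ α₂ β₁ β₂ γ + (α₁ + α₂)|)
      (Eventually.of_forall fun n => ?_)
    rw [tiltedEigenvector]
    split_ifs <;> simp
  have habs : Tendsto (fun n : ℤ => |(n : ℝ)|) cofinite atTop :=
    tendsto_norm_comp_cofinite_atTop_of_isClosedEmbedding Int.isClosedEmbedding_coe_real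
  have hexp : (fun n : ℤ => Real.exp (γ * n)) =o[cofinite]
      fun n : ℤ => Real.exp ((|γ| + 1) * |(n : ℝ)|) := by
    refine Real.isLittleO_exp_comp_exp_comp.2 (tendsto_atTop_mono (fun n => ?_) habs)
    have : γ * n ≤ |γ| * |(n : ℝ)| := (le_abs_self _).trans_eq (abs_mul _ _)
    linarith
  simpa using hexp.mul_isBigO hvector

theorem IsMarkovChain.integral_exp_mul_tiltedEigenvector (hX : IsMarkovChain P X)
    (hG : HasGenerator P X (alternatingGenerator α₁ α₂ β₁ β₂)) (h : UnconfinedRates α₁ α₂ β₁ β₂)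
    (γ : ℝ) (k : ℤ) (t : ℝ≥0) :
    Integrable (fun ω => Real.exp (γ * X t ω) * tiltedEigenvector α₁ α₂ β₁ β₂ γ (X t ω)) (P k) ∧
      ∫ ω, Real.exp (γ * X t ω) * tiltedEigenvector α₁ α₂ β₁ β₂ γ (X t ω) ∂(P k) =
        Real.exp (LambdaFun α₁ α₂ β₁ β₂ γ * t) *
          (Real.exp (γ * k) * tiltedEigenvector α₁ α₂ β₁ β₂ γ k) := by
  have hsum (k : ℤ) : ∑ j ∈ {k - 1, k, k + 1}, alternatingGenerator α₁ α₂ β₁ β₂ k j = 0 := by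
    simpa using sum_alternatingGenerator_mul α₁ α₂ β₁ β₂ k fun _ => 1
  exact hX.integrable_and_integral_eq_of_hasSum <|
    hX.hasSum_mul_stateProb_of_eigenfunction hG (by simp) hsum
      (fun n => Real.one_le_exp (by positivity))
      (h.sum_abs_alternatingGenerator_mul_exp_abs_le (by positivity))
      (isLittleO_exp_mul_tiltedEigenvector α₁ α₂ β₁ β₂ γ)
      (h.sum_alternatingGenerator_mul_exp_mul_tiltedEigenvector γ) k t

theorem UnconfinedRates.eventually_tiltedEigenvector_mem_Icc (h : UnconfinedRates α₁ α₂ β₁ β₂) :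
    ∀ᶠ γ in 𝓝 0, ∀ n, tiltedEigenvector α₁ α₂ β₁ β₂ γ n ∈
      Set.Icc ((α₁ + α₂) / 2) (2 * (α₁ + α₂)) := by
  have hpos : 0 < α₁ + α₂ := by simpa using h.tiltedRate_pos 0
  have hnhds : Set.Icc ((α₁ + α₂) / 2) (2 * (α₁ + α₂)) ∈ 𝓝 (α₁ + α₂) :=
    Icc_mem_nhds (by linarith) (by linarith)
  have heven : Tendsto (tiltedRate α₁ α₂) (𝓝 0) (𝓝 (α₁ + α₂)) :=
    (contDiff_tiltedRate (n := 0) α₁ α₂).continuous.tendsto' _ _ (tiltedRate_zero α₁ α₂)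
  have hodd : Tendsto (fun γ => LambdaFun α₁ α₂ β₁ β₂ γ + (α₁ + α₂)) (𝓝 0) (𝓝 (α₁ + α₂)) :=
    ((h.contDiff_LambdaFun (n := 0)).continuous.add continuous_const).tendsto' _ _
      (by simp [h.LambdaFun_zero])
  filter_upwards [heven hnhds, hodd hnhds] with γ heven hodd n
  rw [tiltedEigenvector]
  split_ifs
  · exact heven
  · exact hodd

theorem integrable_of_integrable_mul_of_le {f g : Ω → ℝ} {μ : Measure Ω} {c : ℝ}
    (hf : AEStronglyMeasurable f μ) (hc : 0 < c) (hg : ∀ ω, c ≤ g ω)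
    (hint : Integrable (fun ω => f ω * g ω) μ) : Integrable f μ := by
  refine (hint.norm.const_mul c⁻¹).mono' hf (Eventually.of_forall fun ω => ?_)
  have hgω : c ≤ ‖g ω‖ := (hg ω).trans (le_abs_self _)
  rw [norm_mul, mul_left_comm, inv_mul_eq_div]
  exact le_mul_of_one_le_right (norm_nonneg _) ((one_le_div hc).2 hgω)

theorem integrable_exp_and_abs_cgf_sub_le {Y g : Ω → ℝ} {μ : Measure Ω} {γ u w c d : ℝ}
    (hY : AEMeasurable Y μ) (hc : 0 < c) (hg : ∀ ω, g ω ∈ Set.Icc c d) (hw : w ∈ Set.Icc c d)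
    (hint : Integrable (fun ω => Real.exp (γ * Y ω) * g ω) μ)
    (heq : ∫ ω, Real.exp (γ * Y ω) * g ω ∂μ = Real.exp u * w) :
    Integrable (fun ω => Real.exp (γ * Y ω)) μ ∧
      |ProbabilityTheory.cgf Y μ γ - u| ≤ Real.log (d / c) := by
  have hd : 0 < d := hc.trans_le (hw.1.trans hw.2)
  have hexp : Integrable (fun ω => Real.exp (γ * Y ω)) μ :=
    integrable_of_integrable_mul_of_le (hY.const_mul γ).exp.aestronglyMeasurable hc
      (fun ω => (hg ω).1) hint
  have hlower : c * ProbabilityTheory.mgf Y μ γ ≤ Real.exp u * d := by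
    calc c * ∫ ω, Real.exp (γ * Y ω) ∂μ = ∫ ω, Real.exp (γ * Y ω) * c ∂μ := by
          rw [integral_mul_const, mul_comm]
      _ ≤ ∫ ω, Real.exp (γ * Y ω) * g ω ∂μ := integral_mono (hexp.mul_const c) hint fun ω =>
          mul_le_mul_of_nonneg_left (hg ω).1 (Real.exp_pos _).le
      _ ≤ Real.exp u * d := heq.trans_le (mul_le_mul_of_nonneg_left hw.2 (Real.exp_pos _).le)
  have hupper : Real.exp u * c ≤ d * ProbabilityTheory.mgf Y μ γ := by
    calc Real.exp u * c ≤ ∫ ω, Real.exp (γ * Y ω) * g ω ∂μ :=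
          (mul_le_mul_of_nonneg_left hw.1 (Real.exp_pos _).le).trans_eq heq.symm
      _ ≤ ∫ ω, Real.exp (γ * Y ω) * d ∂μ := integral_mono hint (hexp.mul_const d) fun ω =>
          mul_le_mul_of_nonneg_left (hg ω).2 (Real.exp_pos _).le
      _ = d * ∫ ω, Real.exp (γ * Y ω) ∂μ := by rw [integral_mul_const, mul_comm]
  have hmgf : 0 < ProbabilityTheory.mgf Y μ γ :=
    pos_of_mul_pos_right ((mul_pos (Real.exp_pos u) hc).trans_le hupper) hd.le
  refine ⟨hexp, ?_⟩
  have hlower_log := Real.log_le_log (mul_pos hc hmgf) hlower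
  have hupper_log := Real.log_le_log (mul_pos (Real.exp_pos u) hc) hupper
  rw [Real.log_mul hc.ne' hmgf.ne', Real.log_mul (Real.exp_pos u).ne' hd.ne', Real.log_exp]
    at hlower_log
  rw [Real.log_mul hd.ne' hmgf.ne', Real.log_mul (Real.exp_pos u).ne' hc.ne', Real.log_exp]
    at hupper_log
  rw [ProbabilityTheory.cgf, Real.log_div hd.ne' hc.ne', abs_le]
  constructor <;> linarith

theorem IsMarkovChain.exists_abs_cgf_sub_le (hX : IsMarkovChain P X)
    (hG : HasGenerator P X (alternatingGenerator α₁ α₂ β₁ β₂)) (h : UnconfinedRates α₁ α₂ β₁ β₂)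
    (k : ℤ) :
    ∃ C, ∀ᶠ γ in 𝓝 0, ∀ t : ℝ≥0, Integrable (fun ω => Real.exp (γ * X t ω)) (P k) ∧
      |ProbabilityTheory.cgf (fun ω => (X t ω : ℝ)) (P k) γ - t * LambdaFun α₁ α₂ β₁ β₂ γ| ≤ C := by
  have hpos : 0 < α₁ + α₂ := by simpa using h.tiltedRate_pos 0
  have hsmall : ∀ᶠ γ : ℝ in 𝓝 0, |γ * k| ≤ 1 := by
    have : Tendsto (fun γ : ℝ => |γ * k|) (𝓝 0) (𝓝 0) :=
      (continuous_id.mul continuous_const).abs.tendsto' _ _ (by simp)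
    exact this.eventually_le_const one_pos
  refine ⟨Real.log (2 * (α₁ + α₂) / ((α₁ + α₂) / 2)) + 1, ?_⟩
  filter_upwards [h.eventually_tiltedEigenvector_mem_Icc, hsmall] with γ hγ hγk t
  obtain ⟨hint, heq⟩ := hX.integral_exp_mul_tiltedEigenvector hG h γ k t
  rw [← mul_assoc, ← Real.exp_add] at heq
  have hmeas : AEMeasurable (fun ω => (X t ω : ℝ)) (P k) :=
    (measurable_of_countable _ |>.comp (hX.measurable t)).aemeasurable
  obtain ⟨hexp, hcgf⟩ := integrable_exp_and_abs_cgf_sub_le hmeas (half_pos hpos)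
    (fun ω => hγ (X t ω)) (hγ k) hint heq
  refine ⟨hexp, ?_⟩
  rw [abs_le] at *
  constructor <;> linarith

theorem IsMarkovChain.integrable_state (hX : IsMarkovChain P X)
    (hG : HasGenerator P X (alternatingGenerator α₁ α₂ β₁ β₂)) (h : UnconfinedRates α₁ α₂ β₁ β₂)
    (k : ℤ) (t : ℝ≥0) : Integrable (fun ω => (X t ω : ℝ)) (P k) := by
  obtain ⟨C, hC⟩ := hX.exists_abs_cgf_sub_le hG h k
  exact ProbabilityTheory.integrable_of_mem_interior_integrableExpSet
    (mem_interior_iff_mem_nhds.2 (hC.mono fun γ hγ => (hγ t).1))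

end AlternatingChain

/-! ### A Gärtner–Ellis theorem with quadratic limit -/

section QuadraticScaledCGF

variable {Ω ι : Type*} [MeasurableSpace Ω]

theorem cgf_sub_const {μ : Measure Ω} [NeZero μ] {Z : Ω → ℝ} {s : ℝ}
    (h : Integrable (fun ω => Real.exp (s * Z ω)) μ) (c : ℝ) :
    ProbabilityTheory.cgf (fun ω => Z ω - c) μ s = ProbabilityTheory.cgf Z μ s - s * c := by
  simp only [ProbabilityTheory.cgf, sub_eq_add_neg, ProbabilityTheory.mgf_add_const]
  rw [Real.log_mul (ProbabilityTheory.mgf_pos' (NeZero.ne μ) h).ne' (Real.exp_pos _).ne',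
    Real.log_exp, mul_neg]

theorem integrable_exp_mul_sub_const {μ : Measure Ω} {Z : Ω → ℝ} {s : ℝ}
    (h : Integrable (fun ω => Real.exp (s * Z ω)) μ) (c : ℝ) :
    Integrable (fun ω => Real.exp (s * (Z ω - c))) μ := by
  simpa only [mul_sub, Real.exp_sub] using h.div_const (Real.exp (s * c))

theorem mul_integral_le_cgf {μ : Measure Ω} [IsProbabilityMeasure μ] {Z : Ω → ℝ} {s : ℝ}
    (hZ : Integrable Z μ) (h : Integrable (fun ω => Real.exp (s * Z ω)) μ) :
    s * ∫ ω, Z ω ∂μ ≤ ProbabilityTheory.cgf Z μ s := by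
  rw [ProbabilityTheory.cgf, Real.le_log_iff_exp_le (ProbabilityTheory.mgf_pos h),
    ← integral_const_mul]
  exact convexOn_exp.map_integral_le Real.continuous_exp.continuousOn isClosed_univ
    (Eventually.of_forall fun _ => Set.mem_univ _) (hZ.const_mul s) h

theorem measureReal_le_abs_le_two_mul_exp {μ : Measure Ω} [IsFiniteMeasure μ] {Z : Ω → ℝ}
    {θ : ℝ} (hθ : 0 ≤ θ) (hpos : Integrable (fun ω => Real.exp (θ * Z ω)) μ)
    (hneg : Integrable (fun ω => Real.exp (-θ * Z ω)) μ) (r : ℝ) :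
    μ.real {ω | r ≤ |Z ω|} ≤ 2 * Real.exp
      (-θ * r + max (ProbabilityTheory.cgf Z μ θ) (ProbabilityTheory.cgf Z μ (-θ))) := by
  have hsub : {ω | r ≤ |Z ω|} ⊆ {ω | r ≤ Z ω} ∪ {ω | Z ω ≤ -r} := fun ω (hω : r ≤ |Z ω|) =>
    (le_abs.1 hω).imp_right le_neg_of_le_neg
  have hright := ProbabilityTheory.measure_ge_le_exp_cgf r hθ hpos
  have hleft := ProbabilityTheory.measure_le_le_exp_cgf (-r) (neg_nonpos.2 hθ) hneg
  rw [neg_neg, mul_neg, ← neg_mul] at hleft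
  calc μ.real {ω | r ≤ |Z ω|} ≤ μ.real {ω | r ≤ Z ω} + μ.real {ω | Z ω ≤ -r} :=
        (measureReal_mono hsub).trans (measureReal_union_le _ _)
    _ ≤ _ := by
        rw [two_mul]
        refine add_le_add (hright.trans ?_) (hleft.trans ?_) <;> gcongr
        · exact le_max_left _ _
        · exact le_max_right _ _

theorem exp_mul_le_indicator_ball_add (θ y z : ℝ) {δ lam : ℝ} (hlam : 0 ≤ lam) :
    Real.exp (θ * z) ≤ (Metric.ball y δ).indicator (fun _ => Real.exp (θ * y + |θ| * δ)) z +
      (Real.exp (-(lam * (y + δ))) * Real.exp ((θ + lam) * z) +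
        Real.exp (lam * (y - δ)) * Real.exp ((θ - lam) * z)) := by
  by_cases hz : z ∈ Metric.ball y δ
  · rw [Set.indicator_of_mem hz]
    refine le_add_of_le_of_nonneg (Real.exp_le_exp.2 ?_) (by positivity)
    have hθz : θ * (z - y) ≤ |θ| * δ := (le_abs_self _).trans <| (abs_mul _ _).trans_le <|
      mul_le_mul_of_nonneg_left (Metric.mem_ball.1 hz).le (abs_nonneg θ)
    linarith
  · rw [Set.indicator_of_notMem hz, zero_add, ← Real.exp_add, ← Real.exp_add]
    have hδ : δ ≤ |z - y| := not_lt.1 hz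
    rcases le_abs.1 hδ with hright | hleft
    · refine le_add_of_le_of_nonneg (Real.exp_le_exp.2 ?_) (Real.exp_pos _).le
      linarith [mul_le_mul_of_nonneg_left hright hlam]
    · refine le_add_of_nonneg_of_le (Real.exp_pos _).le (Real.exp_le_exp.2 ?_)
      linarith [mul_le_mul_of_nonneg_left hleft hlam]

/-- The last two terms bound the mass outside the ball of the tilted law `e ^ (θ Z - cgf θ) dμ`. -/
theorem one_le_exp_mul_measureReal_ball_add {μ : Measure Ω} [IsProbabilityMeasure μ] {Z : Ω → ℝ}
    (hZ : Measurable Z) {θ lam : ℝ} (hlam : 0 ≤ lam)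
    (h : Integrable (fun ω => Real.exp (θ * Z ω)) μ)
    (hadd : Integrable (fun ω => Real.exp ((θ + lam) * Z ω)) μ)
    (hsub : Integrable (fun ω => Real.exp ((θ - lam) * Z ω)) μ) (y δ : ℝ) :
    1 ≤ Real.exp (θ * y + |θ| * δ - ProbabilityTheory.cgf Z μ θ) *
        μ.real (Z ⁻¹' Metric.ball y δ) +
      (Real.exp (ProbabilityTheory.cgf Z μ (θ + lam) - ProbabilityTheory.cgf Z μ θ
          - lam * (y + δ)) +
        Real.exp (ProbabilityTheory.cgf Z μ (θ - lam) - ProbabilityTheory.cgf Z μ θ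
          + lam * (y - δ))) := by
  have hball : MeasurableSet (Z ⁻¹' Metric.ball y δ) := hZ Metric.isOpen_ball.measurableSet
  have hind : Integrable ((Z ⁻¹' Metric.ball y δ).indicator
      fun _ => Real.exp (θ * y + |θ| * δ)) μ := (integrable_const _).indicator hball
  have hadd' := hadd.const_mul (Real.exp (-(lam * (y + δ))))
  have hsub' := hsub.const_mul (Real.exp (lam * (y - δ)))
  have hmgf : ProbabilityTheory.mgf Z μ θ ≤
      μ.real (Z ⁻¹' Metric.ball y δ) * Real.exp (θ * y + |θ| * δ) +
        (Real.exp (-(lam * (y + δ))) * ProbabilityTheory.mgf Z μ (θ + lam) +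
          Real.exp (lam * (y - δ)) * ProbabilityTheory.mgf Z μ (θ - lam)) := by
    refine (integral_mono h (hind.add (hadd'.add hsub'))
      fun ω => exp_mul_le_indicator_ball_add θ y (Z ω) hlam).trans_eq ?_
    rw [integral_add' hind (hadd'.add hsub'), integral_add' hadd' hsub', integral_const_mul,
      integral_const_mul, integral_indicator hball, setIntegral_const, smul_eq_mul]
    rfl
  rw [← ProbabilityTheory.exp_cgf h, ← ProbabilityTheory.exp_cgf hadd,
    ← ProbabilityTheory.exp_cgf hsub] at hmgf
  refine le_of_mul_le_mul_right ?_ (Real.exp_pos (ProbabilityTheory.cgf Z μ θ))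
  rw [one_mul]
  refine hmgf.trans_eq ?_
  simp only [Real.exp_sub, Real.exp_add, Real.exp_neg]
  field_simp

theorem mul_log_le_of_le_exp {a x : ℝ} {m : ℝ≥0∞} (ha : 0 ≤ a)
    (h : m ≤ ENNReal.ofReal (Real.exp x)) : (a : EReal) * ENNReal.log m ≤ (a * x : ℝ) := by
  rw [EReal.coe_mul, ← Real.log_exp x, ← ENNReal.log_ofReal_of_pos (Real.exp_pos x)]
  exact mul_le_mul_of_nonneg_left (ENNReal.log_monotone h) (EReal.coe_nonneg.2 ha)

theorem le_mul_log_of_exp_le {a x : ℝ} {m : ℝ≥0∞} (ha : 0 ≤ a)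
    (h : ENNReal.ofReal (Real.exp x) ≤ m) : ((a * x : ℝ) : EReal) ≤ a * ENNReal.log m := by
  rw [EReal.coe_mul, ← Real.log_exp x, ← ENNReal.log_ofReal_of_pos (Real.exp_pos x)]
  exact mul_le_mul_of_nonneg_left (ENNReal.log_monotone h) (EReal.coe_nonneg.2 ha)

theorem le_neg_coe_of_forall_nnreal_le {L : EReal} {I : ℝ≥0∞}
    (h : ∀ η : ℝ≥0, (η : ℝ≥0∞) ≤ I → L ≤ ((-η : ℝ) : EReal)) : L ≤ -(I : EReal) := by
  have hL (η : ℝ≥0) (hη : (η : ℝ≥0∞) ≤ I) : ((η : ℝ≥0∞) : EReal) ≤ -L := EReal.le_neg.1 (h η hη)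
  rw [EReal.le_neg, ← EReal.coe_toENNReal (x := -L) (by simpa using hL 0 zero_le),
    EReal.coe_ennreal_le_coe_ennreal_iff]
  refine ENNReal.le_of_forall_nnreal_lt fun η hη => ?_
  rw [← EReal.toENNReal_coe (x := (η : ℝ≥0∞))]
  exact EReal.toENNReal_le_toENNReal (hL η hη.le)

theorem neg_iInf_le_of_forall_neg_le {α : Type*} {s : Set α} {f : α → ℝ} {L : EReal}
    (h : ∀ y ∈ s, ((-f y : ℝ) : EReal) ≤ L) :
    -((⨅ y ∈ s, ENNReal.ofReal (f y) : ℝ≥0∞) : EReal) ≤ L := by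
  rw [EReal.neg_le]
  refine ((le_max_right _ _).trans_eq EReal.coe_toENNReal_eq_max.symm).trans
    (EReal.coe_ennreal_le_coe_ennreal_iff.2 ?_)
  refine le_iInf₂ fun y hy => ?_
  rw [← EReal.real_coe_toENNReal]
  exact EReal.toENNReal_le_toENNReal (EReal.neg_le.1 (h y hy))

/-- The scaled cumulant generating functions of `Z t` under `μ t`, with speed `1 / a t`, converge
to the quadratic function `V θ² / 2`. Integrability is part of the notion because `cgf` is `0` at
parameters where the exponential is not integrable. -/
def HasQuadraticScaledCGF (μ : ι → Measure Ω) (Z : ι → Ω → ℝ) (a : ι → ℝ) (l : Filter ι)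
    (V : ℝ) : Prop :=
  ∀ θ : ℝ, (∀ᶠ t in l, Integrable (fun ω => Real.exp (θ / a t * Z t ω)) (μ t)) ∧
    Tendsto (fun t => a t * ProbabilityTheory.cgf (Z t) (μ t) (θ / a t)) l (𝓝 (V * θ ^ 2 / 2))

namespace HasQuadraticScaledCGF

variable {l : Filter ι} {μ : ι → Measure Ω} {Z : ι → Ω → ℝ} {a : ι → ℝ} {V : ℝ}

theorem limsup_mul_log_le_abs_le [l.NeBot] [∀ t, IsFiniteMeasure (μ t)]
    (h : HasQuadraticScaledCGF μ Z a l V) (hV : 0 < V) (ha : Tendsto a l (𝓝[>] 0))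
    {r : ℝ} (hr : 0 ≤ r) :
    limsup (fun t => (a t : EReal) * ENNReal.log (μ t {ω | r ≤ |Z t ω|})) l ≤
      ((-(r ^ 2 / (2 * V)) : ℝ) : EReal) := by
  have ha_pos : ∀ᶠ t in l, 0 < a t := (tendsto_nhdsWithin_iff.1 ha).2
  set b : ι → ℝ := fun t => Real.log 2 + (-(r / V / a t) * r +
    max (ProbabilityTheory.cgf (Z t) (μ t) (r / V / a t))
      (ProbabilityTheory.cgf (Z t) (μ t) (-(r / V / a t)))) with hb
  have hb_lim : Tendsto (fun t => a t * b t) l (𝓝 (-(r ^ 2 / (2 * V)))) := by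
    have hcgf := (h (r / V)).2.max (h (-(r / V))).2
    have hlog := (tendsto_nhdsWithin_iff.1 ha).1.mul_const (Real.log 2)
    refine ((hlog.add_const (-(r / V * r))).add hcgf).congr' ?_ |>.trans_eq ?_
    · filter_upwards [ha_pos] with t hat
      rw [hb, ← mul_max_of_nonneg _ _ hat.le, neg_div]
      field_simp
      ring
    · congr 1
      rw [neg_sq, max_self]
      field_simp
      ring
  have hb_lim' : Tendsto (fun t => ((a t * b t : ℝ) : EReal)) l _ :=
    (continuous_coe_real_ereal.tendsto _).comp hb_lim
  rw [← hb_lim'.limsup_eq]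
  refine limsup_le_limsup ?_
  filter_upwards [ha_pos, (h (r / V)).1, (h (-(r / V))).1] with t hat hpos hneg
  rw [neg_div] at hneg
  refine mul_log_le_of_le_exp hat.le ?_
  rw [← ofReal_measureReal, Real.exp_add, Real.exp_log two_pos]
  exact ENNReal.ofReal_le_ofReal (measureReal_le_abs_le_two_mul_exp (by positivity) hpos hneg r)

theorem limsup_le [l.NeBot] [∀ t, IsFiniteMeasure (μ t)] (h : HasQuadraticScaledCGF μ Z a l V)
    (hV : 0 < V) (ha : Tendsto a l (𝓝[>] 0)) (C : Set ℝ) :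
    limsup (fun t => (a t : EReal) * ENNReal.log (μ t (Z t ⁻¹' C))) l ≤
      -((⨅ y ∈ C, ENNReal.ofReal (y ^ 2 / (2 * V)) : ℝ≥0∞) : EReal) := by
  refine le_neg_coe_of_forall_nnreal_le fun η hη => ?_
  have hsq : Real.sqrt (2 * V * η) ^ 2 = 2 * V * η := Real.sq_sqrt (by positivity)
  have hC : ∀ y ∈ C, Real.sqrt (2 * V * η) ≤ |y| := by
    intro y hy
    have hηy := hη.trans (iInf₂_le y hy)
    rw [ENNReal.le_ofReal_iff_toReal_le ENNReal.coe_ne_top (by positivity),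
      ENNReal.coe_toReal, le_div_iff₀ (by positivity)] at hηy
    exact Real.sqrt_le_iff.2 ⟨abs_nonneg _, by rw [sq_abs]; linarith⟩
  have hlim := h.limsup_mul_log_le_abs_le hV ha (Real.sqrt_nonneg (2 * V * η))
  rw [hsq, mul_div_cancel_left₀ _ (by positivity)] at hlim
  refine (limsup_le_limsup ?_).trans hlim
  filter_upwards [(tendsto_nhdsWithin_iff.1 ha).2] with t hat
  exact mul_le_mul_of_nonneg_left
    (ENNReal.log_monotone (measure_mono fun ω hω => hC (Z t ω) hω)) (EReal.coe_nonneg.2 hat.le)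

theorem eventually_exp_cgf_sub_add_le [∀ t, IsProbabilityMeasure (μ t)]
    (h : HasQuadraticScaledCGF μ Z a l V) (ha : Tendsto a l (𝓝[>] 0)) {θ θ' c : ℝ}
    (hc : V * θ' ^ 2 / 2 - V * θ ^ 2 / 2 + c < 0) :
    ∀ᶠ t in l, Real.exp (ProbabilityTheory.cgf (Z t) (μ t) (θ' / a t) -
      ProbabilityTheory.cgf (Z t) (μ t) (θ / a t) + c / a t) ≤ 1 / 4 := by
  have hlim := (((h θ').2.sub (h θ).2).add_const c).neg_mul_atTop hc
    (tendsto_inv_nhdsGT_zero.comp ha)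
  have hexp := (Real.tendsto_exp_atBot.comp hlim).eventually_le_const (u := 1 / 4) (by norm_num)
  filter_upwards [hexp, (tendsto_nhdsWithin_iff.1 ha).2] with t ht hat
  refine (le_of_eq ?_).trans ht
  have hat' : a t ≠ 0 := ne_of_gt hat
  simp only [Function.comp]
  congr 1
  field_simp

theorem eventually_exp_le_measureReal_ball [∀ t, IsProbabilityMeasure (μ t)]
    (h : HasQuadraticScaledCGF μ Z a l V) (hZ : ∀ t, Measurable (Z t)) (hV : 0 < V)
    (ha : Tendsto a l (𝓝[>] 0)) (y : ℝ) {δ : ℝ} (hδ : 0 < δ) :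
    ∀ᶠ t in l, Real.exp (ProbabilityTheory.cgf (Z t) (μ t) (y / V / a t) -
        (y / V * y + |y / V| * δ) / a t - Real.log 2) ≤
      (μ t).real (Z t ⁻¹' Metric.ball y δ) := by
  set θ := y / V with hθ
  set lam := δ / V with hlam
  have hright : V * (θ + lam) ^ 2 / 2 - V * θ ^ 2 / 2 + -(lam * (y + δ)) < 0 := calc
    _ = -(δ ^ 2 / (2 * V)) := by rw [hθ, hlam]; field_simp; ring
    _ < 0 := neg_neg_of_pos (by positivity)
  have hleft : V * (θ - lam) ^ 2 / 2 - V * θ ^ 2 / 2 + lam * (y - δ) < 0 := calc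
    _ = -(δ ^ 2 / (2 * V)) := by rw [hθ, hlam]; field_simp; ring
    _ < 0 := neg_neg_of_pos (by positivity)
  filter_upwards [(tendsto_nhdsWithin_iff.1 ha).2, (h θ).1, (h (θ + lam)).1, (h (θ - lam)).1,
    h.eventually_exp_cgf_sub_add_le ha hright, h.eventually_exp_cgf_sub_add_le ha hleft]
    with t (hat : 0 < a t) hint hadd hsub hright_le hleft_le
  have hcenter : θ / a t * y + |θ / a t| * δ = (θ * y + |θ| * δ) / a t := by
    rw [abs_div, abs_of_pos hat]; ring
  have hc_right : -(lam * (y + δ)) / a t = -(lam / a t * (y + δ)) := by ring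
  have hc_left : lam * (y - δ) / a t = lam / a t * (y - δ) := by ring
  rw [add_div] at hadd
  rw [sub_div] at hsub
  rw [add_div, hc_right, ← sub_eq_add_neg] at hright_le
  rw [sub_div, hc_left] at hleft_le
  have hone := one_le_exp_mul_measureReal_ball_add (hZ t) (by positivity : 0 ≤ lam / a t)
    hint hadd hsub y δ
  rw [hcenter] at hone
  rw [Real.exp_sub, Real.exp_log two_pos, ← neg_sub, Real.exp_neg, div_le_iff₀ two_pos,
    inv_le_iff_one_le_mul₀' (Real.exp_pos _)]
  linarith

theorem le_liminf_ball [l.NeBot] [∀ t, IsProbabilityMeasure (μ t)]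
    (h : HasQuadraticScaledCGF μ Z a l V) (hZ : ∀ t, Measurable (Z t)) (hV : 0 < V)
    (ha : Tendsto a l (𝓝[>] 0)) (y : ℝ) {δ : ℝ} (hδ : 0 < δ) :
    ((-(y ^ 2 / (2 * V)) - |y| / V * δ : ℝ) : EReal) ≤
      liminf (fun t => (a t : EReal) * ENNReal.log (μ t (Z t ⁻¹' Metric.ball y δ))) l := by
  have ha_pos : ∀ᶠ t in l, 0 < a t := (tendsto_nhdsWithin_iff.1 ha).2
  set b : ι → ℝ := fun t => ProbabilityTheory.cgf (Z t) (μ t) (y / V / a t) -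
    (y / V * y + |y / V| * δ) / a t - Real.log 2 with hb
  have hb_lim : Tendsto (fun t => a t * b t) l (𝓝 (-(y ^ 2 / (2 * V)) - |y| / V * δ)) := by
    have hlog := (tendsto_nhdsWithin_iff.1 ha).1.mul_const (Real.log 2)
    refine (((h (y / V)).2.sub_const (y / V * y + |y / V| * δ)).sub hlog).congr' ?_ |>.trans_eq ?_
    · filter_upwards [ha_pos] with t hat
      rw [hb]
      field_simp
    · congr 1
      rw [abs_div, abs_of_pos hV]
      field_simp
      ring
  have hb_lim' : Tendsto (fun t => ((a t * b t : ℝ) : EReal)) l _ :=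
    (continuous_coe_real_ereal.tendsto _).comp hb_lim
  rw [← hb_lim'.liminf_eq]
  refine liminf_le_liminf ?_
  filter_upwards [ha_pos, h.eventually_exp_le_measureReal_ball hZ hV ha y hδ] with t hat hle
  refine le_mul_log_of_exp_le hat.le ?_
  rw [← ofReal_measureReal]
  exact ENNReal.ofReal_le_ofReal hle

theorem le_liminf [l.NeBot] [∀ t, IsProbabilityMeasure (μ t)]
    (h : HasQuadraticScaledCGF μ Z a l V) (hZ : ∀ t, Measurable (Z t)) (hV : 0 < V)
    (ha : Tendsto a l (𝓝[>] 0)) {O : Set ℝ} (hO : IsOpen O) :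
    -((⨅ y ∈ O, ENNReal.ofReal (y ^ 2 / (2 * V)) : ℝ≥0∞) : EReal) ≤
      liminf (fun t => (a t : EReal) * ENNReal.log (μ t (Z t ⁻¹' O))) l := by
  refine neg_iInf_le_of_forall_neg_le fun y hy => ?_
  obtain ⟨δ₀, hδ₀, hball⟩ := Metric.isOpen_iff.1 hO y hy
  have hlim : Tendsto (fun δ : ℝ => ((-(y ^ 2 / (2 * V)) - |y| / V * δ : ℝ) : EReal)) (𝓝[>] 0)
      (𝓝 ((-(y ^ 2 / (2 * V)) : ℝ) : EReal)) :=
    (continuous_coe_real_ereal.comp (by fun_prop)).tendsto' _ _ (by simp) |>.mono_left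
      nhdsWithin_le_nhds
  refine le_of_tendsto hlim ?_
  filter_upwards [Ioc_mem_nhdsGT hδ₀] with δ hδ
  refine (h.le_liminf_ball hZ hV ha y hδ.1).trans (liminf_le_liminf ?_)
  filter_upwards [(tendsto_nhdsWithin_iff.1 ha).2] with t hat
  have hsub : Z t ⁻¹' Metric.ball y δ ⊆ Z t ⁻¹' O :=
    Set.preimage_mono ((Metric.ball_subset_ball hδ.2).trans hball)
  exact mul_le_mul_of_nonneg_left (ENNReal.log_monotone (measure_mono hsub))
    (EReal.coe_nonneg.2 (le_of_lt hat))

theorem satisfiesLDP {μ : ℝ≥0 → Measure Ω} [∀ t, IsProbabilityMeasure (μ t)]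
    {Z : ℝ≥0 → Ω → ℝ} {a : ℝ≥0 → ℝ} (h : HasQuadraticScaledCGF μ Z a atTop V)
    (hZ : ∀ t, Measurable (Z t)) (hV : 0 < V) (ha : Tendsto a atTop (𝓝[>] 0)) :
    SatisfiesLDP (fun t => (μ t).map (Z t)) (fun t => 1 / a t)
      (fun y => ENNReal.ofReal (y ^ 2 / (2 * V))) where
  isProbabilityMeasure t _ := Measure.isProbabilityMeasure_map (hZ t).aemeasurable
  speed := by simpa only [one_div, Function.comp_def] using tendsto_inv_nhdsGT_zero.comp ha
  lsc := (ENNReal.continuous_ofReal.comp (by fun_prop)).lowerSemicontinuous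
  lower O hO := by
    simpa only [one_div_one_div, Measure.map_apply (hZ _) hO.measurableSet]
      using h.le_liminf hZ hV ha hO
  upper C hC := by
    simpa only [one_div_one_div, Measure.map_apply (hZ _) hC.measurableSet]
      using h.limsup_le hV ha C

theorem tendsto_integral [∀ t, IsProbabilityMeasure (μ t)] (h : HasQuadraticScaledCGF μ Z a l V)
    (ha : Tendsto a l (𝓝[>] 0)) (hint : ∀ t, Integrable (Z t) (μ t)) :
    Tendsto (fun t => ∫ ω, Z t ω ∂μ t) l (𝓝 0) := by
  have hJensen (θ : ℝ) (hθ : θ ≠ 0) :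
      ∀ᶠ t in l, θ * ∫ ω, Z t ω ∂μ t ≤ (V / 2 + 1) * θ ^ 2 := by
    have hlt : V * θ ^ 2 / 2 < (V / 2 + 1) * θ ^ 2 := by
      linarith [sq_pos_of_ne_zero hθ]
    filter_upwards [(h θ).1, (h θ).2.eventually_le_const hlt, (tendsto_nhdsWithin_iff.1 ha).2]
      with t hexp hle (hat : 0 < a t)
    have hcgf := mul_le_mul_of_nonneg_left (mul_integral_le_cgf (hint t) hexp) hat.le
    rw [← mul_assoc, mul_div_cancel₀ _ hat.ne'] at hcgf
    exact hcgf.trans hle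
  refine Metric.tendsto_nhds.2 fun ε hε => ?_
  have hsmall : Tendsto (fun θ : ℝ => (V / 2 + 1) * θ) (𝓝[>] 0) (𝓝 0) :=
    (continuous_const.mul continuous_id).tendsto' _ _ (by simp) |>.mono_left nhdsWithin_le_nhds
  obtain ⟨θ, hθε, hθ : 0 < θ⟩ := ((hsmall.eventually_lt_const hε).and self_mem_nhdsWithin).exists
  filter_upwards [hJensen θ hθ.ne', hJensen (-θ) (neg_ne_zero.2 hθ.ne')] with t hupper hlower
  rw [dist_zero_right, Real.norm_eq_abs, abs_lt]
  constructor <;> nlinarith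

theorem sub_integral [∀ t, IsProbabilityMeasure (μ t)] (h : HasQuadraticScaledCGF μ Z a l V)
    (ha : Tendsto a l (𝓝[>] 0)) (hint : ∀ t, Integrable (Z t) (μ t)) :
    HasQuadraticScaledCGF μ (fun t ω => Z t ω - ∫ ω', Z t ω' ∂μ t) a l V := by
  refine fun θ => ⟨(h θ).1.mono fun t ht => integrable_exp_mul_sub_const ht _, ?_⟩
  have hlim := (h θ).2.sub ((h.tendsto_integral ha hint).const_mul θ)
  rw [mul_zero, sub_zero] at hlim
  refine hlim.congr' ?_
  filter_upwards [(h θ).1, (tendsto_nhdsWithin_iff.1 ha).2] with t hexp (hat : 0 < a t)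
  rw [cgf_sub_const hexp]
  field_simp

end HasQuadraticScaledCGF

end QuadraticScaledCGF

theorem isGoodRate_quadratic {V : ℝ} (hV : 0 < V) :
    IsGoodRate fun y : ℝ => ENNReal.ofReal (y ^ 2 / (2 * V)) := by
  intro η
  have hbounded : Bornology.IsBounded {y : ℝ | ENNReal.ofReal (y ^ 2 / (2 * V)) ≤ η} := by
    refine (Metric.isBounded_Icc (-Real.sqrt (2 * V * η)) (Real.sqrt (2 * V * η))).subset ?_
    intro y (hy : ENNReal.ofReal (y ^ 2 / (2 * V)) ≤ (η : ℝ≥0∞))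
    rw [ENNReal.ofReal_le_iff_le_toReal ENNReal.coe_ne_top, ENNReal.coe_toReal,
      div_le_iff₀ (by positivity)] at hy
    exact abs_le.1 (Real.abs_le_sqrt (by linarith))
  exact Metric.isCompact_of_isClosed_isBounded
    (isClosed_le (ENNReal.continuous_ofReal.comp (by fun_prop)) continuous_const) hbounded

/-! ### Moderate deviations -/

section ModerateDeviations

theorem tendsto_mul_sub_of_isLittleO {ι : Type*} {l : Filter ι} {Λ : ℝ → ℝ} {b V C q : ℝ}
    {τ a γ κ : ι → ℝ} (hΛ : (fun γ => Λ γ - b * γ - V * γ ^ 2 / 2) =o[𝓝 0] fun γ => γ ^ 2)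
    (hκ : ∀ᶠ t in l, |κ t - τ t * Λ (γ t)| ≤ C) (ha : Tendsto a l (𝓝 0))
    (hγ : Tendsto γ l (𝓝 0)) (hγ_sq : ∀ᶠ t in l, τ t * a t * γ t ^ 2 = q) :
    Tendsto (fun t => a t * (κ t - γ t * (τ t * b))) l (𝓝 (V * q / 2)) := by
  have hbounded : Tendsto (fun t => a t * (κ t - τ t * Λ (γ t))) l (𝓝 0) :=
    ha.zero_mul_isBoundedUnder_le ⟨C, by simpa using hκ⟩
  have hremainder : Tendsto (fun t => τ t * a t *
      (Λ (γ t) - b * γ t - V * γ t ^ 2 / 2)) l (𝓝 0) := by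
    have hlittle := (Asymptotics.isBigO_refl (fun t => τ t * a t) l).mul_isLittleO
      (hΛ.comp_tendsto hγ)
    have hconst : (fun t => τ t * a t * γ t ^ 2) =O[l] fun _ => (1 : ℝ) :=
      (Asymptotics.isBigO_const_const q one_ne_zero l).congr' (hγ_sq.mono fun _ h => h.symm)
        EventuallyEq.rfl
    exact (Asymptotics.isLittleO_one_iff ℝ).1 (hlittle.trans_isBigO hconst)
  have hsum := (hbounded.add hremainder).add_const (V * q / 2)
  rw [zero_add, zero_add] at hsum
  refine hsum.congr' (hγ_sq.mono fun t ht => ?_)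
  linear_combination (-(V / 2)) * ht

theorem hasQuadraticScaledCGF_of_abs_cgf_sub_le {Ω : Type*} [MeasurableSpace Ω] {μ : Measure Ω}
    [NeZero μ] {Y : ℝ≥0 → Ω → ℝ} {Λ : ℝ → ℝ} {b V C : ℝ}
    (hcgf : ∀ᶠ γ in 𝓝 0, ∀ t : ℝ≥0, Integrable (fun ω => Real.exp (γ * Y t ω)) μ ∧
      |ProbabilityTheory.cgf (Y t) μ γ - t * Λ γ| ≤ C)
    (hΛ : (fun γ => Λ γ - b * γ - V * γ ^ 2 / 2) =o[𝓝 0] fun γ => γ ^ 2)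
    {a : ℝ≥0 → ℝ} (ha : Tendsto a atTop (𝓝 0))
    (hta : Tendsto (fun t : ℝ≥0 => (t : ℝ) * a t) atTop atTop) :
    HasQuadraticScaledCGF (fun _ => μ)
      (fun t ω => Real.sqrt (t * a t) * ((Y t ω - t * b) / t)) a atTop V := by
  intro θ
  set γ : ℝ≥0 → ℝ := fun t => θ / Real.sqrt (t * a t) with hγ_def
  have hγ : Tendsto γ atTop (𝓝 0) := (Real.tendsto_sqrt_atTop.comp hta).const_div_atTop θ
  have hγ_sq : ∀ᶠ t : ℝ≥0 in atTop, t * a t * γ t ^ 2 = θ ^ 2 := by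
    filter_upwards [hta.eventually_gt_atTop 0] with t ht
    rw [hγ_def, div_pow, Real.sq_sqrt ht.le, mul_div_cancel₀ _ ht.ne']
  have hexponent (t : ℝ≥0) (ω : Ω) :
      θ / a t * (Real.sqrt (t * a t) * ((Y t ω - t * b) / t)) = γ t * (Y t ω - t * b) := by
    have hdiv : Real.sqrt (t * a t) / (t * a t) = 1 / Real.sqrt (t * a t) := Real.sqrt_div_self'
    linear_combination (θ * (Y t ω - t * b)) * hdiv
  have hcgf_γ := hγ.eventually hcgf
  have hlim := tendsto_mul_sub_of_isLittleO hΛ (hcgf_γ.mono fun t h => (h t).2) ha hγ hγ_sq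
  constructor
  · filter_upwards [hcgf_γ] with t h
    simpa only [hexponent] using integrable_exp_mul_sub_const (h t).1 (t * b)
  · refine hlim.congr' ?_
    filter_upwards [hcgf_γ] with t h
    rw [← cgf_sub_const (h t).1]
    simp only [ProbabilityTheory.cgf, ProbabilityTheory.mgf, hexponent]

theorem satisfiesLDP_of_abs_cgf_sub_le {Ω : Type*} [MeasurableSpace Ω] {μ : Measure Ω}
    [IsProbabilityMeasure μ] {Y : ℝ≥0 → Ω → ℝ} (hY : ∀ t, Measurable (Y t))
    (hint : ∀ t, Integrable (Y t) μ) {Λ : ℝ → ℝ} {b V C : ℝ} (hV : 0 < V)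
    (hcgf : ∀ᶠ γ in 𝓝 0, ∀ t : ℝ≥0, Integrable (fun ω => Real.exp (γ * Y t ω)) μ ∧
      |ProbabilityTheory.cgf (Y t) μ γ - t * Λ γ| ≤ C)
    (hΛ : (fun γ => Λ γ - b * γ - V * γ ^ 2 / 2) =o[𝓝 0] fun γ => γ ^ 2)
    {a : ℝ≥0 → ℝ} (ha : Tendsto a atTop (𝓝 0))
    (hta : Tendsto (fun t : ℝ≥0 => (t : ℝ) * a t) atTop atTop) :
    SatisfiesLDP (fun t : ℝ≥0 => μ.map fun ω =>
        Real.sqrt (t * a t) * ((Y t ω - ∫ ω', Y t ω' ∂μ) / t))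
      (fun t => 1 / a t) (fun y => ENNReal.ofReal (y ^ 2 / (2 * V))) := by
  have ha_pos : ∀ᶠ t in atTop, 0 < a t :=
    (hta.eventually_gt_atTop 0).mono fun t ht => pos_of_mul_pos_right ht t.coe_nonneg
  have ha' : Tendsto a atTop (𝓝[>] 0) := tendsto_nhdsWithin_iff.2 ⟨ha, ha_pos⟩
  have hscaled (t : ℝ≥0) :
      Integrable (fun ω => Real.sqrt (t * a t) * ((Y t ω - t * b) / t)) μ :=
    (((hint t).sub (integrable_const _)).div_const _).const_mul _
  have hcentered (t : ℝ≥0) (ω : Ω) : Real.sqrt (t * a t) * ((Y t ω - t * b) / t) -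
      ∫ ω', Real.sqrt (t * a t) * ((Y t ω' - t * b) / t) ∂μ =
      Real.sqrt (t * a t) * ((Y t ω - ∫ ω', Y t ω' ∂μ) / t) := by
    rw [integral_const_mul, integral_div, integral_sub (hint t) (integrable_const _),
      integral_const, probReal_univ, one_smul]
    ring
  have h := (hasQuadraticScaledCGF_of_abs_cgf_sub_le hcgf hΛ ha hta).sub_integral ha' hscaled
  simp only [hcentered] at h
  exact h.satisfiesLDP (fun t => (((hY t).sub_const _).div_const _).const_mul _) hV ha'

end ModerateDeviations

theorem proposition3p3_general {Ω : Type*} [MeasurableSpace Ω] (P : ℤ → Measure Ω)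
    (X : ℝ≥0 → Ω → ℤ) (α₁ α₂ β₁ β₂ : ℝ) (h : α₁ * β₁ + α₂ * β₂ ≠ 0)
    (hX : IsMarkovChain P X)
    (hG : HasGenerator P X (alternatingGenerator α₁ α₂ β₁ β₂))
    (a : ℝ≥0 → ℝ) (ha : Tendsto a atTop (𝓝 0))
    (hta : Tendsto (fun t : ℝ≥0 => (t : ℝ) * a t) atTop atTop) :
    0 < LambdaSecond α₁ α₂ β₁ β₂ ∧
    ∀ k : ℤ,
      (∀ t, Integrable (fun ω => (X t ω : ℝ)) (P k)) ∧
      SatisfiesLDP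
        (fun t : ℝ≥0 => (P k).map (fun ω =>
          Real.sqrt ((t : ℝ) * a t) * (((X t ω : ℝ) - ∫ ω', (X t ω' : ℝ) ∂(P k)) / (t : ℝ))))
        (fun t => 1 / a t)
        (fun y : ℝ => ENNReal.ofReal (y ^ 2 / (2 * LambdaSecond α₁ α₂ β₁ β₂))) ∧
      IsGoodRate (fun y : ℝ => ENNReal.ofReal (y ^ 2 / (2 * LambdaSecond α₁ α₂ β₁ β₂))) := by
  have hrates := hX.unconfinedRates hG h
  have hV := hrates.LambdaSecond_pos
  refine ⟨hV, fun k => ⟨hX.integrable_state hG hrates k, ?_, isGoodRate_quadratic hV⟩⟩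
  have := hX.isProbabilityMeasure k
  have hmeas (t : ℝ≥0) : Measurable fun ω => (X t ω : ℝ) :=
    (measurable_of_countable _).comp (hX.measurable t)
  obtain ⟨C, hC⟩ := hX.exists_abs_cgf_sub_le hG hrates k
  exact satisfiesLDP_of_abs_cgf_sub_le hmeas (hX.integrable_state hG hrates k) hV hC
    hrates.LambdaFun_sub_isLittleO ha hta

theorem proposition3p3 {Ω : Type*} [MeasurableSpace Ω] (P : ℤ → Measure Ω) (X : ℝ≥0 → Ω → ℤ)
    (α₁ α₂ β₁ β₂ : ℝ) (hα₁ : 0 < α₁) (hα₂ : 0 < α₂) (hβ₁ : 0 < β₁) (hβ₂ : 0 < β₂)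
    (hX : IsMarkovChain P X)
    (hG : HasGenerator P X (alternatingGenerator α₁ α₂ β₁ β₂))
    (a : ℝ≥0 → ℝ) (ha_pos : ∀ t, 0 < t → 0 < a t)
    (ha : Tendsto a atTop (𝓝 0))
    (hta : Tendsto (fun t : ℝ≥0 => (t : ℝ) * a t) atTop atTop) :
    0 < LambdaSecond α₁ α₂ β₁ β₂ ∧
    ∀ k : ℤ,
      (∀ t, Integrable (fun ω => (X t ω : ℝ)) (P k)) ∧
      SatisfiesLDP
        (fun t : ℝ≥0 => (P k).map (fun ω =>
          Real.sqrt ((t : ℝ) * a t) * (((X t ω : ℝ) - ∫ ω', (X t ω' : ℝ) ∂(P k)) / (t : ℝ))))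
        (fun t => 1 / a t)
        (fun y : ℝ => ENNReal.ofReal (y ^ 2 / (2 * LambdaSecond α₁ α₂ β₁ β₂))) ∧
      IsGoodRate (fun y : ℝ => ENNReal.ofReal (y ^ 2 / (2 * LambdaSecond α₁ α₂ β₁ β₂))) := by
  exact proposition3p3_general P X α₁ α₂ β₁ β₂ (by positivity) hX hG a ha hta
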